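/- **Model.** Let $A=(a_{ij})$ be a symmetric $n\times n$ matrix of nonnegative edge weights, $\deg(i)=\sum_j a_{ij}$, $D=\mathrm{diag}(\deg(1),\dots,\deg(n))$, and suppose that $W=D^{-1}A$ is irreducible. Let $\gamma_i\in(0,\infty)$, $\gamma_i\neq 1$ (bias parameters), $\Gamma=\mathrm{diag}(\gamma_1,\dots,\gamma_n)$, and let $b_i^1\in(0,1)$, $b_i^0=1-b_i^1$ (initial settings). Agents $i=1,\dots,n$ declare opinions $\psi_{i,t}\in\{0,1\}$ at steps $t=2,3,\dots$. Let $\mathcal H_t$ be the history $\sigma(\psi_{j,\tau}: 1\le j\le n,\ 2\le\tau\le t)$ and, for $t\ge1$, put $$\beta_i(t)=\frac{b_i^1}{t}+\frac1t\sum_{\tau=2}^t\psi_{i,\tau},\qquad \mu_i(t)=\frac{M_i^1(t)}{M_i^0(t)+M_i^1(t)},$$ $$M_i^1(t)=\sum_j a_{ij}b_j^1+\sum_{\tau=2}^t\sum_j a_{ij}\psi_{j,\tau},\qquad M_i^0(t)=\sum_j a_{ij}b_j^0+\sum_{\tau=2}^t\sum_j a_{ij}(1-\psi_{j,\tau}).$$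 For every $t\ge1$, conditionally on $\mathcal H_t$, the declarations $\psi_{1,t+1},\dots,\psi_{n,t+1}$ are independent and $\psi_{i,t+1}=1$ with probability $f(\mu_i(t),\gamma_i)$, where $f(\mu,\gamma)=\frac{\gamma\mu}{1+(\gamma-1)\mu}$, and $\psi_{i,t+1}=0$ otherwise. **Theorem.** Let $\lambda=\lambda_{\max}(\Gamma W)$ be the largest eigenvalue of $\Gamma W$ and suppose that $\lambda<1$ (the case of consensus to $0$). Let $v$ be the left eigenvector of $\Gamma W$ for the eigenvalue $\lambda$ with $\sum_i v_i=1$ (positive, by the Perron–Frobenius theorem), and let $V(\beta)=v^{\top}\beta$. Then, almost surely, for every $\varepsilon>0$, $$\lim_{t\to\infty}\frac{V(\beta(t))}{t^{\lambda-1+\varepsilon}}=0\qquad\text{and}\qquad \lim_{t\to\infty}\frac{V(\beta(t))}{t^{\lambda-1-\varepsilon}}=\infty .$$ -/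

import Mathlib

open MeasureTheory ProbabilityTheory Filter Topology

noncomputable section

/-- Parameters of the interacting Pólya urn model with `n` agents: symmetric nonnegative edge weights
`a i j` whose normalized adjacency matrix is irreducible (connected graph, self-loops allowed), the
bias parameters `γ i` and the initial settings `b i` (`= b_i^1`, with `b_i^0 = 1 - b_i^1`). -/
structure OpinionModel (n : ℕ) where
  /-- edge weights -/
  a : Matrix (Fin n) (Fin n) ℝ
  /-- bias parameters towards opinion `1` -/
  γ : Fin n → ℝ
  /-- initial settings -/
  b : Fin n → ℝ
  a_nonneg : ∀ i j, 0 ≤ a i j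
  a_symm : a.IsSymm
  irreducible : (Matrix.diagonal (fun i => (∑ j, a i j)⁻¹) * a).IsIrreducible
  γ_pos : ∀ i, 0 < γ i
  γ_ne_one : ∀ i, γ i ≠ 1
  b_pos : ∀ i, 0 < b i
  b_lt_one : ∀ i, b i < 1

/-- The probability of declaring `1`: `f(μ, γ) = γ μ / (1 + (γ - 1) μ)`. -/
def declareProb (μ γ : ℝ) : ℝ := γ * μ / (1 + (γ - 1) * μ)

/-- The largest (real) eigenvalue of a square matrix. -/
def lambdaMax {n : ℕ} (M : Matrix (Fin n) (Fin n) ℝ) : ℝ :=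
  sSup {x : ℝ | Module.End.HasEigenvalue (Matrix.toLin' M) x}

/-- The numerical value (`1` or `0`) of a declared opinion. -/
def opinionValue (o : Bool) : ℝ := if o then 1 else 0

namespace OpinionModel

variable {n : ℕ} (N : OpinionModel n)

/-- The weighted degree of agent `i`. -/
def deg (i : Fin n) : ℝ := ∑ j, N.a i j

/-- The normalized adjacency matrix `W = D⁻¹ A`. -/
def W : Matrix (Fin n) (Fin n) ℝ := Matrix.diagonal (fun i => (N.deg i)⁻¹) * N.a

/-- The matrix `Γ W`, with `Γ = diag(γ)`. -/
def ΓW : Matrix (Fin n) (Fin n) ℝ := Matrix.diagonal N.γ * N.W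

/-! Below, a path `p : ℕ → Fin n → Bool` lists the declared opinions `p τ i` of agent `i` at the
steps `τ`; only the steps `τ ≥ 2` matter, the initial settings replacing step `1`. -/

/-- `M_i^1(t)`: weighted number of declarations of `1` observed by agent `i` up to time `t`,
plus the initial settings. -/
def countOne (p : ℕ → Fin n → Bool) (t : ℕ) (i : Fin n) : ℝ :=
  ∑ j, N.a i j * N.b j + ∑ τ ∈ Finset.Icc 2 t, ∑ j, N.a i j * opinionValue (p τ j)

/-- `M_i^0(t)`: weighted number of declarations of `0` observed by agent `i` up to time `t`,
plus the initial settings. -/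
def countZero (p : ℕ → Fin n → Bool) (t : ℕ) (i : Fin n) : ℝ :=
  ∑ j, N.a i j * (1 - N.b j) + ∑ τ ∈ Finset.Icc 2 t, ∑ j, N.a i j * (1 - opinionValue (p τ j))

/-- `μ_i(t) = M_i^1(t) / M_i(t)`, the proportion of opinion `1` observed by agent `i`,
where `M_i(t) = M_i^0(t) + M_i^1(t)`. -/
def observed (p : ℕ → Fin n → Bool) (t : ℕ) (i : Fin n) : ℝ :=
  N.countOne p t i / (N.countZero p t i + N.countOne p t i)

/-- `β_i(t)`, the proportion of declarations of `1` made by agent `i` up to time `t`. -/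
def declared (p : ℕ → Fin n → Bool) (t : ℕ) (i : Fin n) : ℝ :=
  N.b i / t + 1 / t * ∑ τ ∈ Finset.Icc 2 t, opinionValue (p τ i)

end OpinionModel

/-- The history `H_t`: the σ-algebra generated by the declarations made at the steps `2, …, t`. -/
abbrev declHistory {Ω : Type*} {n : ℕ} (ψ : ℕ → Ω → Fin n → Bool) (t : ℕ) : MeasurableSpace Ω :=
  ⨆ τ ∈ Finset.Icc 2 t, MeasurableSpace.comap (ψ τ) inferInstance

/-- `ψ` is a realization of the opinion dynamics on `(Ω, P)`: for every `t ≥ 1`, conditionally on the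
history `H_t`, the declarations `ψ_{i,t+1}` are independent over the agents `i`, and `ψ_{i,t+1}` is
`1` with probability `f(μ_i(t), γ_i)` and `0` otherwise. -/
structure IsOpinionProcess {Ω : Type*} [MeasurableSpace Ω] {n : ℕ} (N : OpinionModel n)
    (P : Measure Ω) (ψ : ℕ → Ω → Fin n → Bool) : Prop where
  measurable : ∀ t, Measurable (ψ t)
  cond_law : ∀ t : ℕ, 1 ≤ t → ∀ x : Fin n → Bool,
    P⟦{ω | ψ (t + 1) ω = x} | declHistory ψ t⟧ =ᵐ[P] fun ω =>
      ∏ i, if x i then declareProb (N.observed (fun τ => ψ τ ω) t i) (N.γ i)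
        else 1 - declareProb (N.observed (fun τ => ψ τ ω) t i) (N.γ i)

end

/-! Let X(t) be the v-weighted count of declared 1s, so that V(β(t)) = X(t)/t. Since v is a left
eigenvector of ΓW, once all proportions of 1s tend to 0 the conditional mean increment of X is (λ +
o(1)) X/t, which suggests growth like exp(∑ λ/s) ≈ t^λ. Two nonnegative supermartingales make this
rigorous: `ae_tally_le_exp` and `ae_exp_le_tally` bound X by exponentials of its accumulated
relative drift, and `exists_le_rpow` and `exists_rpow_le` turn these into powers of t.

It remains to show that the proportions of 1s do tend to 0 (`FollowsDrift.tendsto_ones`). Consensus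
to 1 is unstable: Cauchy–Schwarz (`le_lambdaMax_mul_sum`) converts v into weights for which rare 0s
have a drift exceeding their proportion by a factor ρ > 1, so that 0s cannot stay rare
(`ae_eventually_le_weightedZeros`). A one-sided law of large numbers (`ae_ones_le`) and
irreducibility pass this on to every agent. Hence the odds of 1 are eventually at most θ times the
right eigenvector for some θ. As f multiplies odds by γ and s/(1+s) is concave, θ may be replaced by
lθ for any l > λ (`FollowsDrift.eventually_ones_le`); iterating with λ < l < 1 drives the odds to 0.
-/

noncomputable section

/-! ### One-step transition probabilities. -/

namespace OpinionModel

variable {n : ℕ} (N : OpinionModel n)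

/-- The probability that the agents declare the opinions `x` at step `t + 1`, given the path up to
time `t`. -/
def transProb (p : ℕ → Fin n → Bool) (t : ℕ) (x : Fin n → Bool) : ℝ :=
  ∏ i, if x i then declareProb (N.observed p t i) (N.γ i)
    else 1 - declareProb (N.observed p t i) (N.γ i)

/-- Expand a product of sums over agents in which only the `i`-th factor carries `g`; every other
factor sums to 1. -/
theorem sum_transProb_mul (p : ℕ → Fin n → Bool) (t : ℕ) (i : Fin n) (g : Bool → ℝ) :
    ∑ x, N.transProb p t x * g (x i) =
      declareProb (N.observed p t i) (N.γ i) * g true +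
        (1 - declareProb (N.observed p t i) (N.γ i)) * g false := by
  have h := Fintype.prod_sum (fun (k : Fin n) (o : Bool) =>
    (if o then declareProb (N.observed p t k) (N.γ k)
      else 1 - declareProb (N.observed p t k) (N.γ k)) * (if k = i then g o else 1))
  simp only [Finset.prod_mul_distrib, Finset.prod_ite_eq', Finset.mem_univ, if_true] at h
  unfold transProb
  rw [← h, Finset.prod_eq_single i]
  · simp
  · intro k _ hk
    simp [hk]
  · simp

theorem sum_transProb (p : ℕ → Fin n → Bool) (t : ℕ) : ∑ x, N.transProb p t x = 1 := by
  have h := Fintype.prod_sum (fun (k : Fin n) (o : Bool) =>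
    (if o then declareProb (N.observed p t k) (N.γ k)
      else 1 - declareProb (N.observed p t k) (N.γ k)))
  unfold transProb
  rw [← h]
  simp

end OpinionModel

/-! ### Conditioning on the history, and supermartingales of the path. -/

section Histories

variable {Ω : Type*} {n : ℕ} {ψ : ℕ → Ω → Fin n → Bool}

/-- A function of the path that depends only on the steps `2, …, t`. -/
def DependsUpTo (t : ℕ) (g : (ℕ → Fin n → Bool) → ℝ) : Prop :=
  ∀ p q : ℕ → Fin n → Bool, (∀ τ ∈ Finset.Icc 2 t, p τ = q τ) → g p = g q

/-- Only finitely many path segments exist, so measurability and boundedness come for free from this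
factorization. -/
theorem DependsUpTo.exists_factor {t : ℕ} {g : (ℕ → Fin n → Bool) → ℝ} (hg : DependsUpTo t g) :
    ∃ F : (Finset.Icc 2 t → Fin n → Bool) → ℝ, ∀ p, g p = F fun τ => p τ := by
  refine ⟨fun y => g fun τ => if h : τ ∈ Finset.Icc 2 t then y ⟨τ, h⟩ else fun _ => false,
    fun p => hg _ _ fun τ hτ => ?_⟩
  simp only [dif_pos hτ]

theorem DependsUpTo.stronglyMeasurable {t : ℕ} {g : (ℕ → Fin n → Bool) → ℝ}
    (hg : DependsUpTo t g) : StronglyMeasurable[declHistory ψ t] fun ω => g fun τ => ψ τ ω := by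
  obtain ⟨F, hF⟩ := hg.exists_factor
  simp only [hF]
  refine Measurable.stronglyMeasurable ?_
  have h1 : Measurable[declHistory ψ t] fun ω => fun τ : Finset.Icc 2 t => ψ τ ω := by
    refine @measurable_pi_lambda _ _ _ (declHistory ψ t) _ _ fun τ => ?_
    rw [measurable_iff_comap_le]
    exact le_iSup₂_of_le τ.1 τ.2 le_rfl
  exact (Measurable.of_discrete (f := F)).comp h1

theorem DependsUpTo.exists_bound {t : ℕ} {g : (ℕ → Fin n → Bool) → ℝ} (hg : DependsUpTo t g) :
    ∃ C, ∀ p, ‖g p‖ ≤ C := by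
  obtain ⟨F, hF⟩ := hg.exists_factor
  obtain ⟨C, hC⟩ := (Set.finite_range fun y => ‖F y‖).bddAbove
  exact ⟨C, fun p => by rw [hF]; exact hC ⟨_, rfl⟩⟩

variable [MeasurableSpace Ω]

theorem declHistory_le (hψ : ∀ t, Measurable (ψ t)) (t : ℕ) :
    declHistory ψ t ≤ ‹MeasurableSpace Ω› :=
  iSup₂_le fun τ _ => (hψ τ).comap_le

theorem DependsUpTo.integrable (hψ : ∀ t, Measurable (ψ t)) (P : Measure Ω)
    [IsProbabilityMeasure P] {t : ℕ} {g : (ℕ → Fin n → Bool) → ℝ} (hg : DependsUpTo t g) :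
    Integrable (fun ω => g fun τ => ψ τ ω) P := by
  obtain ⟨C, hC⟩ := hg.exists_bound
  exact Integrable.of_bound
    ((hg.stronglyMeasurable (ψ := ψ)).mono (declHistory_le hψ t)).aestronglyMeasurable C
    (ae_of_all _ fun ω => hC _)

/-- The histories `H_1 ≤ H_2 ≤ …` as a filtration. -/
def declFiltration (hψ : ∀ t, Measurable (ψ t)) : Filtration ℕ ‹MeasurableSpace Ω› where
  seq t := declHistory ψ (t + 1)
  mono' s t hst := biSup_mono fun τ hτ => by
    simp only [Finset.mem_Icc] at hτ ⊢
    omega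
  le' t := declHistory_le hψ _

variable {P : Measure Ω} [IsProbabilityMeasure P] {N : OpinionModel n}

/-- Split according to the value `x` of the last declaration: overwriting that step by `x` leaves a
factor measurable for the history, which is pulled out, and the indicator of the event has the
prescribed conditional law. -/
theorem condExp_path_succ (hψ : IsOpinionProcess N P ψ) {t : ℕ} (ht : 1 ≤ t)
    {g : (ℕ → Fin n → Bool) → ℝ} (hg : DependsUpTo (t + 1) g) :
    P[fun ω => g fun τ => ψ τ ω | declHistory ψ t] =ᵐ[P] fun ω =>
      ∑ x, N.transProb (fun τ => ψ τ ω) t x *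
        g (Function.update (fun τ => ψ τ ω) (t + 1) x) := by
  have hdep : ∀ x, DependsUpTo t fun p => g (Function.update p (t + 1) x) := by
    intro x p q hpq
    refine hg _ _ fun τ hτ => ?_
    rcases eq_or_ne τ (t + 1) with rfl | h
    · simp
    · rw [Function.update_of_ne h, Function.update_of_ne h]
      refine hpq τ ?_
      simp only [Finset.mem_Icc] at hτ ⊢
      omega
  have hset : ∀ x : Fin n → Bool, MeasurableSet {ω | ψ (t + 1) ω = x} := fun x =>
    hψ.measurable (t + 1) (measurableSet_singleton x)
  have hind : ∀ x : Fin n → Bool,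
      Integrable ({ω | ψ (t + 1) ω = x}.indicator fun _ => (1 : ℝ)) P := fun x =>
    (integrable_const 1).indicator (hset x)
  have hint : ∀ x : Fin n → Bool, Integrable
      (({ω | ψ (t + 1) ω = x}.indicator fun _ => (1 : ℝ)) *
        fun ω => g (Function.update (fun τ => ψ τ ω) (t + 1) x)) P := by
    intro x
    obtain ⟨C, hC⟩ := (hdep x).exists_bound
    exact (hind x).mul_bdd (c := C) ((hdep x).integrable hψ.measurable P).aestronglyMeasurable
      (ae_of_all _ fun ω => hC _)
  have hsum : (fun ω => g fun τ => ψ τ ω) = ∑ x : Fin n → Bool,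
      ({ω | ψ (t + 1) ω = x}.indicator fun _ => (1 : ℝ)) *
        fun ω => g (Function.update (fun τ => ψ τ ω) (t + 1) x) := by
    funext ω
    rw [Finset.sum_apply, Finset.sum_eq_single (ψ (t + 1) ω)]
    · simp
    · intro x _ hx
      simp [Ne.symm hx]
    · simp
  rw [hsum]
  refine (condExp_finsetSum (fun x _ => hint x) _).trans ?_
  have hall : ∀ᵐ ω ∂P, ∀ x : Fin n → Bool,
      (P[({ω | ψ (t + 1) ω = x}.indicator fun _ => (1 : ℝ)) *
        fun ω => g (Function.update (fun τ => ψ τ ω) (t + 1) x) | declHistory ψ t]) ω =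
      N.transProb (fun τ => ψ τ ω) t x *
        g (Function.update (fun τ => ψ τ ω) (t + 1) x) := by
    rw [ae_all_iff]
    intro x
    filter_upwards [condExp_mul_of_stronglyMeasurable_right
      ((hdep x).stronglyMeasurable (ψ := ψ)) (hint x) (hind x), hψ.cond_law t ht x] with ω h1 h2
    rw [h1, Pi.mul_apply]
    congr 1
  filter_upwards [hall] with ω hω
  rw [Finset.sum_apply]
  exact Finset.sum_congr rfl fun x _ => hω x

/-- Convergence of nonnegative supermartingales, for a functional of the path whose conditional
expectation is controlled pathwise. -/
theorem ae_exists_tendsto_of_path_supermartingale (hψ : IsOpinionProcess N P ψ)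
    (G : ℕ → (ℕ → Fin n → Bool) → ℝ) (hdep : ∀ t, DependsUpTo t (G t))
    (hpos : ∀ t p, 1 ≤ t → 0 ≤ G t p)
    (hstep : ∀ t p, 1 ≤ t →
      ∑ x, N.transProb p t x * G (t + 1) (Function.update p (t + 1) x) ≤ G t p) :
    ∀ᵐ ω ∂P, ∃ c, Tendsto (fun t => G t fun τ => ψ τ ω) atTop (𝓝 c) := by
  have hsuper : Supermartingale (fun t ω => G (t + 1) fun τ => ψ τ ω)
      (declFiltration hψ.measurable) P := by
    refine supermartingale_nat (fun t => (hdep (t + 1)).stronglyMeasurable)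
      (fun t => (hdep (t + 1)).integrable hψ.measurable P) fun t => ?_
    filter_upwards [condExp_path_succ hψ (Nat.le_add_left 1 t) (hdep (t + 1 + 1))] with ω hω
    exact hω.le.trans (hstep _ _ (Nat.le_add_left 1 t))
  -- By nonnegativity the L¹ norm is the mean, which never exceeds its initial value.
  have hbdd : ∀ t, eLpNorm ((-fun t ω => G (t + 1) fun τ => ψ τ ω) t) 1 P ≤
      (∫ ω, G 1 (fun τ => ψ τ ω) ∂P).toNNReal := by
    intro t
    have h1 : ∫ ω, G (t + 1) (fun τ => ψ τ ω) ∂P ≤ ∫ ω, G 1 (fun τ => ψ τ ω) ∂P := by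
      simpa using hsuper.setIntegral_le (Nat.zero_le t) MeasurableSet.univ
    rw [Pi.neg_apply, eLpNorm_neg, eLpNorm_one_eq_lintegral_enorm,
      ← ofReal_integral_norm_eq_lintegral_enorm ((hdep (t + 1)).integrable hψ.measurable P)]
    refine ENNReal.ofReal_le_ofReal ?_
    simpa only [Real.norm_of_nonneg (hpos _ _ (Nat.le_add_left 1 t))] using h1
  filter_upwards [hsuper.neg.exists_ae_tendsto_of_bdd hbdd] with ω hω
  obtain ⟨c, hc⟩ := hω
  refine ⟨-c, (tendsto_add_atTop_iff_nat 1).1 ?_⟩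
  simpa using hc.neg

end Histories

/-! ### Bounds for the response function. -/

theorem declareProb_pos {μ γ : ℝ} (hγ : 0 < γ) (h0 : 0 < μ) (h1 : μ < 1) :
    0 < declareProb μ γ :=
  div_pos (mul_pos hγ h0) (by nlinarith)

theorem declareProb_lt_one {μ γ : ℝ} (hγ : 0 < γ) (h0 : 0 < μ) (h1 : μ < 1) :
    declareProb μ γ < 1 := by
  unfold declareProb
  rw [div_lt_one (by nlinarith)]
  nlinarith

/-- Exchanging the two opinions inverts the bias; lower bounds for declaring 1 thereby apply to
declaring 0. -/
theorem one_sub_declareProb {μ γ : ℝ} (hγ : 0 < γ) (h0 : 0 < μ) (h1 : μ < 1) :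
    1 - declareProb μ γ = declareProb (1 - μ) γ⁻¹ := by
  unfold declareProb
  have h2 : 0 < 1 + (γ - 1) * μ := by nlinarith
  have h3 : 0 < 1 + (γ⁻¹ - 1) * (1 - μ) := by
    have := inv_pos.2 hγ
    nlinarith
  have h4 : γ * (1 + (γ⁻¹ - 1) * (1 - μ)) = 1 + (γ - 1) * μ := by
    field_simp
    ring
  rw [eq_div_iff h3.ne', ← mul_right_inj' hγ.ne', one_sub_div h2.ne', ← mul_assoc, mul_comm γ,
    mul_assoc, h4, div_mul_cancel₀ _ h2.ne']
  field_simp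
  ring

/-- The denominator 1 + (γ - 1)μ lies between 1 - μ and 1 + γμ; this gives the linearization at μ =
0 from both sides. -/
theorem le_declareProb {μ γ : ℝ} (hγ : 0 < γ) (h0 : 0 < μ) (h1 : μ < 1) :
    γ * μ / (1 + γ * μ) ≤ declareProb μ γ := by
  unfold declareProb
  have := mul_pos hγ h0
  exact div_le_div_of_nonneg_left this.le (by nlinarith) (by nlinarith)

theorem declareProb_le {μ γ : ℝ} (hγ : 0 < γ) (h0 : 0 < μ) (h1 : μ < 1) :
    declareProb μ γ ≤ γ * μ / (1 - μ) := by
  unfold declareProb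
  have := mul_pos hγ h0
  exact div_le_div_of_nonneg_left this.le (by linarith) (by nlinarith)

/-- If the odds of `μ` are at most `y`, the odds of `declareProb μ γ` are at most `γ y`. -/
theorem declareProb_le_of_le_odds {μ γ y : ℝ} (hγ : 0 < γ) (h0 : 0 < μ) (h1 : μ < 1) (hy : 0 < y)
    (h : μ ≤ y / (1 + y)) : declareProb μ γ ≤ γ * y / (1 + γ * y) := by
  unfold declareProb
  have hgy := mul_pos hγ hy
  rw [le_div_iff₀ (by linarith)] at h
  rw [div_le_div_iff₀ (by nlinarith) (by linarith)]
  nlinarith [mul_le_mul_of_nonneg_left h hγ.le]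

theorem opinionValue_nonneg (o : Bool) : 0 ≤ opinionValue o := by
  cases o <;> simp [opinionValue]

theorem opinionValue_le_one (o : Bool) : opinionValue o ≤ 1 := by
  cases o <;> simp [opinionValue]

/-! ### Cumulative scores of a path. -/

section Tally

variable {n : ℕ}

theorem DependsUpTo.update_eq {t : ℕ} {g : (ℕ → Fin n → Bool) → ℝ} (hg : DependsUpTo t g)
    (p : ℕ → Fin n → Bool) (x : Fin n → Bool) : g (Function.update p (t + 1) x) = g p := by
  refine hg _ _ fun τ hτ => Function.update_of_ne ?_ _ _
  simp only [Finset.mem_Icc] at hτ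
  omega

theorem DependsUpTo.mono {s t : ℕ} (hst : s ≤ t) {g : (ℕ → Fin n → Bool) → ℝ}
    (hg : DependsUpTo s g) : DependsUpTo t g :=
  fun p q h => hg p q fun τ hτ => h τ (Finset.Icc_subset_Icc_right hst hτ)

theorem DependsUpTo.sum_Ico {h : ℕ → (ℕ → Fin n → Bool) → ℝ} (hh : ∀ s, DependsUpTo s (h s))
    (t : ℕ) : DependsUpTo t fun p => ∑ s ∈ Finset.Ico 1 t, h s p :=
  fun p q hpq => Finset.sum_congr rfl fun s hs =>
    (hh s).mono (Finset.mem_Ico.1 hs).2.le p q hpq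

/-- The initial value `x₀` plus the total of the scores `ξ` of the declarations up to time `t`. -/
def tally (x₀ : ℝ) (ξ : (Fin n → Bool) → ℝ) (t : ℕ) (p : ℕ → Fin n → Bool) : ℝ :=
  x₀ + ∑ τ ∈ Finset.Icc 2 t, ξ (p τ)

variable (x₀ : ℝ) (ξ : (Fin n → Bool) → ℝ)

theorem dependsUpTo_tally (t : ℕ) : DependsUpTo t (tally x₀ ξ t) := fun p q h => by
  unfold tally
  rw [Finset.sum_congr rfl fun τ hτ => by rw [h τ hτ]]

theorem tally_one (p : ℕ → Fin n → Bool) : tally x₀ ξ 1 p = x₀ := by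
  simp [tally]

theorem tally_succ {t : ℕ} (ht : 1 ≤ t) (p : ℕ → Fin n → Bool) :
    tally x₀ ξ (t + 1) p = tally x₀ ξ t p + ξ (p (t + 1)) := by
  unfold tally
  rw [Finset.sum_Icc_succ_top (by omega), add_assoc]

theorem tally_update {t : ℕ} (ht : 1 ≤ t) (p : ℕ → Fin n → Bool) (x : Fin n → Bool) :
    tally x₀ ξ (t + 1) (Function.update p (t + 1) x) = tally x₀ ξ t p + ξ x := by
  rw [tally_succ x₀ ξ ht, (dependsUpTo_tally x₀ ξ t).update_eq, Function.update_self]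

variable {x₀ ξ}

theorem le_tally (hξ : ∀ x, 0 ≤ ξ x) (t : ℕ) (p : ℕ → Fin n → Bool) : x₀ ≤ tally x₀ ξ t p :=
  le_add_of_nonneg_right (Finset.sum_nonneg fun _ _ => hξ _)

theorem tally_le {C : ℝ} (hx₀ : x₀ ≤ C) (hξ : ∀ x, ξ x ≤ C) {t : ℕ} (ht : 1 ≤ t)
    (p : ℕ → Fin n → Bool) : tally x₀ ξ t p ≤ C * t := by
  induction t, ht using Nat.le_induction with
  | base => simpa [tally_one] using hx₀
  | succ t ht ih =>
    rw [tally_succ _ _ ht]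
    push_cast
    linarith [hξ (p (t + 1))]

end Tally

/-! ### The graph, the counts of both opinions, and conditional drifts. -/

namespace OpinionModel

variable {n : ℕ} (N : OpinionModel n)

theorem deg_nonneg (i : Fin n) : 0 ≤ N.deg i := Finset.sum_nonneg fun _ _ => N.a_nonneg _ _

theorem W_apply (i j : Fin n) : N.W i j = (N.deg i)⁻¹ * N.a i j := by
  simp [W, Matrix.diagonal_mul]

theorem ΓW_apply (i j : Fin n) : N.ΓW i j = N.γ i * N.W i j := by
  simp [ΓW, Matrix.diagonal_mul]

theorem W_nonneg (i j : Fin n) : 0 ≤ N.W i j := by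
  rw [W_apply]
  exact mul_nonneg (inv_nonneg.2 (N.deg_nonneg i)) (N.a_nonneg i j)

theorem a_comm (i j : Fin n) : N.a i j = N.a j i := N.a_symm.apply j i

/-- A set of agents that is closed under taking neighbours contains every agent. -/
theorem forall_of_neighbour {Q : Fin n → Prop} (h : ∀ i j, 0 < N.W i j → Q i → Q j) {i : Fin n}
    (hi : Q i) (j : Fin n) : Q j := by
  let := Matrix.toQuiver (Matrix.diagonal (fun i => (∑ j, N.a i j)⁻¹) * N.a)
  obtain ⟨p, -⟩ := N.irreducible.connected i j
  induction p with
  | nil => exact hi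
  | cons q e ih => exact h _ _ e.down ih

theorem exists_neighbour (i : Fin n) : ∃ j, 0 < N.W j i := by
  let := Matrix.toQuiver (Matrix.diagonal (fun i => (∑ j, N.a i j)⁻¹) * N.a)
  obtain ⟨p, hp⟩ := N.irreducible.connected i i
  cases p with
  | nil => simp at hp
  | cons q e => exact ⟨_, e.down⟩

theorem deg_pos (i : Fin n) : 0 < N.deg i := by
  obtain ⟨j, hj⟩ := N.exists_neighbour i
  rw [W_apply] at hj
  have ha : 0 < N.a i j := by
    rw [a_comm]
    exact pos_of_mul_pos_right hj (inv_nonneg.2 (N.deg_nonneg j))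
  exact Finset.sum_pos' (fun _ _ => N.a_nonneg _ _) ⟨j, Finset.mem_univ j, ha⟩

theorem sum_W (i : Fin n) : ∑ j, N.W i j = 1 := by
  simp only [W_apply, ← Finset.mul_sum]
  exact inv_mul_cancel₀ (N.deg_pos i).ne'

theorem W_pos_comm {i j : Fin n} (h : 0 < N.W i j) : 0 < N.W j i := by
  rw [W_apply] at h ⊢
  rw [a_comm]
  exact mul_pos (inv_pos.2 (N.deg_pos j))
    (pos_of_mul_pos_right h (inv_nonneg.2 (N.deg_nonneg i)))

/-- The number of declarations of `1` made by agent `i`, plus the initial setting. -/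
def ones (i : Fin n) : ℕ → (ℕ → Fin n → Bool) → ℝ := tally (N.b i) fun x => opinionValue (x i)

/-- The number of declarations of `0` made by agent `i`, plus the initial setting. -/
def zeros (i : Fin n) : ℕ → (ℕ → Fin n → Bool) → ℝ :=
  tally (1 - N.b i) fun x => 1 - opinionValue (x i)

theorem ones_add_zeros (i : Fin n) {t : ℕ} (ht : 1 ≤ t) (p : ℕ → Fin n → Bool) :
    N.ones i t p + N.zeros i t p = t := by
  induction t, ht using Nat.le_induction with
  | base => simp [ones, zeros, tally_one]
  | succ t ht ih =>
    unfold ones zeros at *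
    rw [tally_succ _ _ ht, tally_succ _ _ ht]
    push_cast
    linarith

theorem ones_pos (i : Fin n) (t : ℕ) (p : ℕ → Fin n → Bool) : 0 < N.ones i t p :=
  (N.b_pos i).trans_le (le_tally (fun _ => opinionValue_nonneg _) t p)

theorem zeros_pos (i : Fin n) (t : ℕ) (p : ℕ → Fin n → Bool) : 0 < N.zeros i t p :=
  (sub_pos.2 (N.b_lt_one i)).trans_le
    (le_tally (fun _ => sub_nonneg.2 (opinionValue_le_one _)) t p)

theorem declared_eq (p : ℕ → Fin n → Bool) (t : ℕ) (i : Fin n) :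
    N.declared p t i = N.ones i t p / t := by
  simp only [declared, ones, tally]
  ring

theorem countOne_eq (p : ℕ → Fin n → Bool) (t : ℕ) (i : Fin n) :
    N.countOne p t i = ∑ j, N.a i j * N.ones j t p := by
  simp only [countOne, ones, tally, mul_add, Finset.sum_add_distrib, Finset.mul_sum]
  rw [Finset.sum_comm]

theorem countZero_eq (p : ℕ → Fin n → Bool) (t : ℕ) (i : Fin n) :
    N.countZero p t i = ∑ j, N.a i j * N.zeros j t p := by
  simp only [countZero, zeros, tally, mul_add, Finset.sum_add_distrib, Finset.mul_sum]
  rw [Finset.sum_comm]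

theorem countZero_add_countOne (p : ℕ → Fin n → Bool) {t : ℕ} (ht : 1 ≤ t) (i : Fin n) :
    N.countZero p t i + N.countOne p t i = N.deg i * t := by
  rw [countOne_eq, countZero_eq, ← Finset.sum_add_distrib, deg, Finset.sum_mul]
  refine Finset.sum_congr rfl fun j _ => ?_
  rw [← N.ones_add_zeros j ht p]
  ring

theorem observed_eq (p : ℕ → Fin n → Bool) {t : ℕ} (ht : 1 ≤ t) (i : Fin n) :
    N.observed p t i = (∑ j, N.W i j * N.ones j t p) / t := by
  rw [observed, countZero_add_countOne N p ht, countOne_eq]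
  simp only [W_apply, mul_assoc, ← Finset.mul_sum]
  have := N.deg_pos i
  field_simp

theorem one_sub_observed_eq (p : ℕ → Fin n → Bool) {t : ℕ} (ht : 1 ≤ t) (i : Fin n) :
    1 - N.observed p t i = (∑ j, N.W i j * N.zeros j t p) / t := by
  have ht' : (t : ℝ) ≠ 0 := by positivity
  rw [observed_eq N p ht, eq_div_iff ht', sub_mul, div_mul_cancel₀ _ ht', sub_eq_iff_eq_add,
    ← Finset.sum_add_distrib, one_mul, ← one_mul (t : ℝ), ← N.sum_W i, Finset.sum_mul]
  refine Finset.sum_congr rfl fun j _ => ?_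
  rw [← N.ones_add_zeros j ht p]
  ring

theorem sum_W_mul_pos (i : Fin n) {x : Fin n → ℝ} (hx : ∀ j, 0 < x j) :
    0 < ∑ j, N.W i j * x j := by
  obtain ⟨j, hj⟩ := N.exists_neighbour i
  exact Finset.sum_pos' (fun j _ => mul_nonneg (N.W_nonneg i j) (hx j).le)
    ⟨j, Finset.mem_univ j, mul_pos (N.W_pos_comm hj) (hx j)⟩

theorem observed_pos (p : ℕ → Fin n → Bool) {t : ℕ} (ht : 1 ≤ t) (i : Fin n) :
    0 < N.observed p t i := by
  rw [observed_eq N p ht]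
  exact div_pos (N.sum_W_mul_pos i fun j => N.ones_pos j t p) (by positivity)

theorem observed_lt_one (p : ℕ → Fin n → Bool) {t : ℕ} (ht : 1 ≤ t) (i : Fin n) :
    N.observed p t i < 1 := by
  rw [← sub_pos, one_sub_observed_eq N p ht]
  exact div_pos (N.sum_W_mul_pos i fun j => N.zeros_pos j t p) (by positivity)

/-- The conditional probability that agent `i` declares `1` at step `t + 1`. -/
def prob (i : Fin n) (t : ℕ) (p : ℕ → Fin n → Bool) : ℝ :=
  declareProb (N.observed p t i) (N.γ i)

theorem prob_pos (i : Fin n) {t : ℕ} (ht : 1 ≤ t) (p : ℕ → Fin n → Bool) : 0 < N.prob i t p :=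
  declareProb_pos (N.γ_pos i) (N.observed_pos p ht i) (N.observed_lt_one p ht i)

theorem prob_lt_one (i : Fin n) {t : ℕ} (ht : 1 ≤ t) (p : ℕ → Fin n → Bool) : N.prob i t p < 1 :=
  declareProb_lt_one (N.γ_pos i) (N.observed_pos p ht i) (N.observed_lt_one p ht i)

theorem transProb_nonneg (p : ℕ → Fin n → Bool) {t : ℕ} (ht : 1 ≤ t) (x : Fin n → Bool) :
    0 ≤ N.transProb p t x := by
  refine Finset.prod_nonneg fun i _ => ?_
  split
  · exact (N.prob_pos i ht p).le
  · exact (sub_pos.2 (N.prob_lt_one i ht p)).le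

theorem dependsUpTo_transProb (t : ℕ) (x : Fin n → Bool) :
    DependsUpTo t fun p => N.transProb p t x := by
  intro p q h
  have h1 : ∀ i, N.observed p t i = N.observed q t i := fun i => by
    simp only [observed, countOne_eq, countZero_eq]
    unfold ones zeros
    simp only [dependsUpTo_tally _ _ t p q h]
  simp only [transProb, h1]

/-- The conditional expectation of the score `ξ` at step `t + 1`. -/
def drift (ξ : (Fin n → Bool) → ℝ) (t : ℕ) (p : ℕ → Fin n → Bool) : ℝ :=
  ∑ x, N.transProb p t x * ξ x

theorem dependsUpTo_drift (ξ : (Fin n → Bool) → ℝ) (t : ℕ) : DependsUpTo t (N.drift ξ t) :=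
  fun p q h => Finset.sum_congr rfl fun x _ => 
    congrArg (· * ξ x) (N.dependsUpTo_transProb t x p q h)

/-- An affine bound for a function of the declarations gives a bound for its conditional
expectation. -/
theorem sum_transProb_mul_le {ξ g : (Fin n → Bool) → ℝ} {c d : ℝ} {t : ℕ} (ht : 1 ≤ t)
    (p : ℕ → Fin n → Bool) (h : ∀ x, g x ≤ c + d * ξ x) :
    ∑ x, N.transProb p t x * g x ≤ c + d * N.drift ξ t p := by
  calc ∑ x, N.transProb p t x * g x
      ≤ ∑ x, N.transProb p t x * (c + d * ξ x) :=
        Finset.sum_le_sum fun x _ => mul_le_mul_of_nonneg_left (h x) (N.transProb_nonneg p ht x)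
    _ = (∑ x, N.transProb p t x) * c + d * N.drift ξ t p := by
        simp only [drift, mul_add, Finset.sum_add_distrib, Finset.sum_mul, Finset.mul_sum]
        congr 1
        exact Finset.sum_congr rfl fun x _ => by ring
    _ = c + d * N.drift ξ t p := by rw [sum_transProb, one_mul]

theorem drift_opinionValue (i : Fin n) (t : ℕ) (p : ℕ → Fin n → Bool) :
    N.drift (fun x => opinionValue (x i)) t p = N.prob i t p := by
  unfold drift
  rw [N.sum_transProb_mul p t i opinionValue]
  simp [opinionValue, prob]

theorem drift_sum (v : Fin n → ℝ) (g : Bool → ℝ) (t : ℕ) (p : ℕ → Fin n → Bool) :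
    N.drift (fun x => ∑ i, v i * g (x i)) t p =
      ∑ i, v i * (N.prob i t p * g true + (1 - N.prob i t p) * g false) := by
  unfold drift
  simp only [Finset.mul_sum]
  rw [Finset.sum_comm]
  refine Finset.sum_congr rfl fun i _ => ?_
  rw [prob, ← N.sum_transProb_mul p t i g, Finset.mul_sum]
  exact Finset.sum_congr rfl fun x _ => by ring

end OpinionModel

/-! ### Almost sure bounds from supermartingales. -/

section AlmostSure

variable {Ω : Type*} [MeasurableSpace Ω] {n : ℕ} {ψ : ℕ → Ω → Fin n → Bool}
variable {P : Measure Ω} [IsProbabilityMeasure P] {N : OpinionModel n}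

theorem ae_exists_forall_le_of_path_supermartingale (hψ : IsOpinionProcess N P ψ)
    (G : ℕ → (ℕ → Fin n → Bool) → ℝ) (hdep : ∀ t, DependsUpTo t (G t))
    (hpos : ∀ t p, 1 ≤ t → 0 ≤ G t p)
    (hstep : ∀ t p, 1 ≤ t →
      ∑ x, N.transProb p t x * G (t + 1) (Function.update p (t + 1) x) ≤ G t p) :
    ∀ᵐ ω ∂P, ∃ K : ℝ, 0 < K ∧ ∀ t, G t (fun τ => ψ τ ω) ≤ K := by
  filter_upwards [ae_exists_tendsto_of_path_supermartingale hψ G hdep hpos hstep] with ω hω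
  obtain ⟨c, hc⟩ := hω
  obtain ⟨K, hK⟩ := hc.bddAbove_range
  exact ⟨max K 1, by positivity, fun t => (hK ⟨t, rfl⟩).trans (le_max_left _ _)⟩

theorem sum_Ico_update {h : ℕ → (ℕ → Fin n → Bool) → ℝ} (hh : ∀ s, DependsUpTo s (h s)) {t : ℕ}
    (ht : 1 ≤ t) (p : ℕ → Fin n → Bool) (x : Fin n → Bool) :
    ∑ s ∈ Finset.Ico 1 (t + 1), h s (Function.update p (t + 1) x) =
      ∑ s ∈ Finset.Ico 1 t, h s p + h t p := by
  rw [Finset.sum_Ico_succ_top ht, (hh t).update_eq, (DependsUpTo.sum_Ico hh t).update_eq]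

variable {x₀ C : ℝ} {ξ : (Fin n → Bool) → ℝ}

/-- The conditional mean X + D of the next value is at most X exp(D/X), so X exp(-∑ D/X) is a
nonnegative supermartingale, hence bounded along almost every path. -/
theorem ae_tally_le_exp (hψ : IsOpinionProcess N P ψ) (hx₀ : 0 < x₀) (hξ : ∀ x, 0 ≤ ξ x) :
    ∀ᵐ ω ∂P, ∃ K : ℝ, 0 < K ∧ ∀ t, tally x₀ ξ t (fun τ => ψ τ ω) ≤ K * Real.exp
      (∑ s ∈ Finset.Ico 1 t, N.drift ξ s (fun τ => ψ τ ω) / tally x₀ ξ s fun τ => ψ τ ω) := by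
  have hX : ∀ t p, 0 < tally x₀ ξ t p := fun t p => hx₀.trans_le (le_tally hξ t p)
  have hdep : ∀ s, DependsUpTo s fun p => N.drift ξ s p / tally x₀ ξ s p := fun s p q h => by
    dsimp only
    rw [N.dependsUpTo_drift ξ s p q h, dependsUpTo_tally x₀ ξ s p q h]
  filter_upwards [ae_exists_forall_le_of_path_supermartingale hψ
    (fun t p => tally x₀ ξ t p *
      Real.exp (-∑ s ∈ Finset.Ico 1 t, N.drift ξ s p / tally x₀ ξ s p))
    (fun t p q h => by
      have h1 := DependsUpTo.sum_Ico hdep t p q h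
      dsimp only at h1 ⊢
      rw [h1, dependsUpTo_tally x₀ ξ t p q h])
    (fun t p _ => mul_nonneg (hX t p).le (Real.exp_pos _).le)
    (fun t p ht => by
      simp only [tally_update x₀ ξ ht, sum_Ico_update hdep ht]
      set X := tally x₀ ξ t p
      set D := N.drift ξ t p
      set S := ∑ s ∈ Finset.Ico 1 t, N.drift ξ s p / tally x₀ ξ s p
      have hXt : 0 < X := hX t p
      refine (N.sum_transProb_mul_le (ξ := ξ) (c := X * Real.exp (-(S + D / X)))
        (d := Real.exp (-(S + D / X))) ht p fun x => by linarith).trans ?_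
      have h1 : X + D ≤ X * Real.exp (D / X) := by
        have := mul_le_mul_of_nonneg_left (Real.add_one_le_exp (D / X)) hXt.le
        rwa [mul_add, mul_div_cancel₀ _ hXt.ne', mul_one, add_comm] at this
      calc X * Real.exp (-(S + D / X)) + Real.exp (-(S + D / X)) * D
          = (X + D) * Real.exp (-(S + D / X)) := by ring
        _ ≤ X * Real.exp (D / X) * Real.exp (-(S + D / X)) := by gcongr
        _ = X * Real.exp (-S) := by
          rw [mul_assoc, ← Real.exp_add]
          congr 2
          ring)] with ω hω
  obtain ⟨K, hK0, hK⟩ := hω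
  refine ⟨K, hK0, fun t => ?_⟩
  have := hK t
  rwa [Real.exp_neg, ← div_eq_mul_inv, div_le_iff₀ (Real.exp_pos _)] at this

/-- The same argument for 1/X: by convexity 1/(X + ξ) lies below its chord over 0 ≤ ξ ≤ C, which
makes X⁻¹ exp(∑ D/(X + C)) a supermartingale. -/
theorem ae_exp_le_tally (hψ : IsOpinionProcess N P ψ) (hx₀ : 0 < x₀) (hξ : ∀ x, 0 ≤ ξ x)
    (hξC : ∀ x, ξ x ≤ C) :
    ∀ᵐ ω ∂P, ∃ κ : ℝ, 0 < κ ∧ ∀ t, κ * Real.exp (∑ s ∈ Finset.Ico 1 t,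
        N.drift ξ s (fun τ => ψ τ ω) / (tally x₀ ξ s (fun τ => ψ τ ω) + C)) ≤
      tally x₀ ξ t fun τ => ψ τ ω := by
  have hX : ∀ t p, 0 < tally x₀ ξ t p := fun t p => hx₀.trans_le (le_tally hξ t p)
  have hdep : ∀ s, DependsUpTo s fun p => N.drift ξ s p / (tally x₀ ξ s p + C) :=
    fun s p q h => by
      dsimp only
      rw [N.dependsUpTo_drift ξ s p q h, dependsUpTo_tally x₀ ξ s p q h]
  filter_upwards [ae_exists_forall_le_of_path_supermartingale hψ
    (fun t p => (tally x₀ ξ t p)⁻¹ *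
      Real.exp (∑ s ∈ Finset.Ico 1 t, N.drift ξ s p / (tally x₀ ξ s p + C)))
    (fun t p q h => by
      have h1 := DependsUpTo.sum_Ico hdep t p q h
      dsimp only at h1 ⊢
      rw [h1, dependsUpTo_tally x₀ ξ t p q h])
    (fun t p _ => mul_nonneg (inv_nonneg.2 (hX t p).le) (Real.exp_pos _).le)
    (fun t p ht => by
      simp only [tally_update x₀ ξ ht, sum_Ico_update hdep ht]
      set X := tally x₀ ξ t p
      set D := N.drift ξ t p
      set S := ∑ s ∈ Finset.Ico 1 t, N.drift ξ s p / (tally x₀ ξ s p + C)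
      have hXt : 0 < X := hX t p
      have hXC : ∀ x, 0 < X + C := fun x => by linarith [hξ x, hξC x]
      refine (N.sum_transProb_mul_le (ξ := ξ) (c := X⁻¹ * Real.exp (S + D / (X + C)))
        (d := -(X⁻¹ / (X + C) * Real.exp (S + D / (X + C)))) ht p fun x => ?_).trans ?_
      · have h1 : (X + ξ x)⁻¹ ≤ X⁻¹ - X⁻¹ / (X + C) * ξ x := by
          have := hXC x
          have h2 : 0 < X + ξ x := by linarith [hξ x]
          have h3 : X⁻¹ - X⁻¹ / (X + C) * ξ x = (X + C - ξ x) / (X * (X + C)) := by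
            field_simp
          rw [h3, inv_eq_one_div, div_le_div_iff₀ h2 (by positivity)]
          nlinarith [mul_nonneg (hξ x) (sub_nonneg.2 (hξC x))]
        have := mul_le_mul_of_nonneg_right h1 (Real.exp_pos (S + D / (X + C))).le
        linarith
      · have h1 : 1 - D / (X + C) ≤ Real.exp (-(D / (X + C))) := by
          linarith [Real.add_one_le_exp (-(D / (X + C)))]
        calc X⁻¹ * Real.exp (S + D / (X + C)) +
              -(X⁻¹ / (X + C) * Real.exp (S + D / (X + C))) * D
            = X⁻¹ * Real.exp (S + D / (X + C)) * (1 - D / (X + C)) := by ring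
          _ ≤ X⁻¹ * Real.exp (S + D / (X + C)) * Real.exp (-(D / (X + C))) := by gcongr
          _ = X⁻¹ * Real.exp S := by
            rw [mul_assoc, ← Real.exp_add]
            congr 2
            ring)] with ω hω
  obtain ⟨K, hK0, hK⟩ := hω
  refine ⟨K⁻¹, inv_pos.2 hK0, fun t => ?_⟩
  have := hK t
  rwa [inv_mul_le_iff₀ (hX t _), mul_comm, ← inv_mul_le_iff₀ hK0] at this

/-- The one-sided law of large numbers for the declarations of agent `i`. -/
theorem ae_ones_le (hψ : IsOpinionProcess N P ψ) (i : Fin n) :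
    ∀ᵐ ω ∂P, ∀ ε : ℝ, 0 < ε → ∃ K : ℝ, ∀ t, 1 ≤ t → N.ones i t (fun τ => ψ τ ω) ≤
      ∑ s ∈ Finset.Ico 1 t, N.prob i s (fun τ => ψ τ ω) + ε * t + K := by
  have hdep : ∀ s, DependsUpTo s fun p => N.prob i s p := fun s p q h => by
    dsimp only
    rw [← N.drift_opinionValue, ← N.drift_opinionValue, N.dependsUpTo_drift _ s p q h]
  -- Exponential supermartingale with parameter r = 1/(m + 1). A countable family of parameters lets
  -- the null set be chosen before ε.
  have key : ∀ m : ℕ, ∀ᵐ ω ∂P, ∃ K : ℝ, 0 < K ∧ ∀ t,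
      Real.exp ((m + 1 : ℝ)⁻¹ * N.ones i t (fun τ => ψ τ ω) - (Real.exp (m + 1 : ℝ)⁻¹ - 1) *
        ∑ s ∈ Finset.Ico 1 t, N.prob i s fun τ => ψ τ ω) ≤ K := by
    intro m
    set r : ℝ := (m + 1 : ℝ)⁻¹
    refine ae_exists_forall_le_of_path_supermartingale hψ (fun t p =>
      Real.exp (r * N.ones i t p - (Real.exp r - 1) * ∑ s ∈ Finset.Ico 1 t, N.prob i s p))
      (fun t p q h => ?_) (fun t p _ => (Real.exp_pos _).le) (fun t p ht => ?_)
    · have h1 := DependsUpTo.sum_Ico hdep t p q h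
      dsimp only at h1 ⊢
      rw [h1, OpinionModel.ones, dependsUpTo_tally _ _ t p q h]
    · simp only [OpinionModel.ones, tally_update _ _ ht, sum_Ico_update hdep ht]
      set X := tally (N.b i) (fun x => opinionValue (x i)) t p
      set S := ∑ s ∈ Finset.Ico 1 t, N.prob i s p
      set e := Real.exp (r * X - (Real.exp r - 1) * (S + N.prob i t p))
      refine (N.sum_transProb_mul_le (ξ := fun x => opinionValue (x i)) (c := e)
        (d := e * (Real.exp r - 1)) ht p fun x => ?_).trans ?_
      · have h1 : Real.exp (r * (X + opinionValue (x i)) -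
            (Real.exp r - 1) * (S + N.prob i t p)) = e * Real.exp (r * opinionValue (x i)) := by
          rw [← Real.exp_add]
          congr 1
          ring
        rw [h1]
        -- On the values 0 and 1, exp(r·) is affine, so nothing is lost here.
        cases x i <;> simp [opinionValue]
        linarith
      · rw [N.drift_opinionValue]
        calc e + e * (Real.exp r - 1) * N.prob i t p
            = e * ((Real.exp r - 1) * N.prob i t p + 1) := by ring
          _ ≤ e * Real.exp ((Real.exp r - 1) * N.prob i t p) := by
            gcongr
            exact Real.add_one_le_exp _
          _ = Real.exp (r * X - (Real.exp r - 1) * S) := by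
            rw [← Real.exp_add]
            congr 1
            ring
  filter_upwards [ae_all_iff.2 key] with ω hω ε hε
  obtain ⟨m, hm⟩ := exists_nat_one_div_lt hε
  obtain ⟨K, hK0, hK⟩ := hω m
  rw [one_div] at hm
  set r : ℝ := (m + 1 : ℝ)⁻¹
  have hr0 : 0 < r := by positivity
  have hr1 : r ≤ 1 := inv_le_one_of_one_le₀ (by linarith [(m.cast_nonneg : (0 : ℝ) ≤ m)])
  -- After division by r, the second-order term costs at most r S ≤ ε t.
  have hexp : Real.exp r - 1 ≤ r * (1 + r) := by
    have := (abs_le.1 (Real.abs_exp_sub_one_sub_id_le (by rwa [abs_of_pos hr0]))).2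
    linarith
  refine ⟨r⁻¹ * Real.log K, fun t ht => ?_⟩
  have h1 := (Real.le_log_iff_exp_le hK0).2 (hK t)
  set S := ∑ s ∈ Finset.Ico 1 t, N.prob i s fun τ => ψ τ ω
  have hS0 : 0 ≤ S := Finset.sum_nonneg fun s hs => (N.prob_pos i (Finset.mem_Ico.1 hs).1 _).le
  have hSt : S ≤ t := by
    calc S ≤ ∑ s ∈ Finset.Ico 1 t, (1 : ℝ) :=
          Finset.sum_le_sum fun s hs => (N.prob_lt_one i (Finset.mem_Ico.1 hs).1 _).le
      _ ≤ t := by simp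
  have h2 : r * N.ones i t (fun τ => ψ τ ω) ≤ r * (S + ε * t + r⁻¹ * Real.log K) := by
    have h3 := mul_le_mul_of_nonneg_right hexp hS0
    have h4 : r * (r * S) ≤ r * (ε * t) := by gcongr
    have h5 : r * (r⁻¹ * Real.log K) = Real.log K := by field_simp
    rw [mul_add, h5]
    linarith
  exact le_of_mul_le_mul_left h2 hr0

/-- If the proportion `tally / t` drifts upwards whenever it is below `δ`, its truncation at `δ`
converges. -/
theorem ae_tendsto_truncation (hψ : IsOpinionProcess N P ψ) (hx₀ : 0 < x₀) (hx₀C : x₀ ≤ C)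
    (hξ : ∀ x, 0 ≤ ξ x) (hξC : ∀ x, ξ x ≤ C) {δ : ℝ}
    (hδ : ∀ t p, 1 ≤ t → tally x₀ ξ t p / t < δ → tally x₀ ξ t p / t ≤ N.drift ξ t p) :
    ∀ᵐ ω ∂P, ∃ c, Tendsto (fun t : ℕ => max (δ - tally x₀ ξ t (fun τ => ψ τ ω) / t) 0 ^ 2)
      atTop (𝓝 c) := by
  have hX : ∀ t p, 0 < tally x₀ ξ t p := fun t p => hx₀.trans_le (le_tally hξ t p)
  filter_upwards [ae_exists_tendsto_of_path_supermartingale hψ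
    -- The increments of the proportion are at most C/(t + 1); the decrease of C²/t pays for their
    -- squares.
    (fun t p => max (δ - tally x₀ ξ t p / t) 0 ^ 2 + C ^ 2 / t)
    (fun t p q h => by
      dsimp only
      rw [dependsUpTo_tally x₀ ξ t p q h])
    (fun t p _ => by positivity)
    (fun t p ht => by
      simp only [tally_update x₀ ξ ht]
      set X := tally x₀ ξ t p
      set D := N.drift ξ t p
      have ht0 : (0 : ℝ) < t := by positivity
      have hXt : 0 < X := hX t p
      set R := X / t
      set m := max (δ - R) 0
      have hm0 : 0 ≤ m := le_max_right _ _
      have hR0 : 0 < R := div_pos hXt ht0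
      have hRC : R ≤ C := (div_le_iff₀ ht0).2 (tally_le hx₀C hξC ht p)
      refine (N.sum_transProb_mul_le (ξ := ξ)
        (c := m ^ 2 + 2 * m * R / (t + 1) + C ^ 2 / (t + 1) ^ 2 + C ^ 2 / (t + 1))
        (d := -(2 * m / (t + 1))) ht p fun x => ?_).trans ?_
      · push_cast
        set r := (ξ x - R) / (t + 1)
        have hr : (X + ξ x) / (t + 1) = R + r := by
          simp only [R, r]
          field_simp
          ring
        have hr2 : r ^ 2 ≤ C ^ 2 / (t + 1) ^ 2 := by
          simp only [r, div_pow]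
          refine div_le_div_of_nonneg_right (sq_le_sq.2 ?_) (by positivity)
          rw [abs_of_nonneg (hR0.le.trans hRC), abs_le]
          constructor <;> linarith [hξ x, hξC x]
        have hmax : max (δ - (R + r)) 0 ^ 2 ≤ (m - r) ^ 2 := by
          rcases le_total (δ - (R + r)) 0 with h | h
          · rw [max_eq_right h, zero_pow two_ne_zero]
            exact sq_nonneg _
          · rw [max_eq_left h]
            have := le_max_left (δ - R) 0
            exact pow_le_pow_left₀ h (by linarith) 2
        rw [hr]
        have h3 : m ^ 2 + 2 * m * R / (t + 1) + C ^ 2 / (t + 1) ^ 2 + C ^ 2 / (t + 1) +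
            -(2 * m / (t + 1)) * ξ x =
            (m - r) ^ 2 + (C ^ 2 / (t + 1) ^ 2 - r ^ 2) + C ^ 2 / (t + 1) := by
          simp only [r]
          ring
        rw [h3]
        linarith
      -- The drift hypothesis is needed only below δ, since the truncation m vanishes above it.
      · have h1 : 0 ≤ m * (D - R) := by
          rcases lt_or_ge R δ with h | h
          · exact mul_nonneg hm0 (sub_nonneg.2 (hδ t p ht h))
          · have : m = 0 := max_eq_right (by linarith)
            simp [this]
        have h2 : C ^ 2 / ((t : ℝ) + 1) ^ 2 + C ^ 2 / (t + 1) ≤ C ^ 2 / t := by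
          rw [div_add_div _ _ (by positivity) (by positivity),
            div_le_div_iff₀ (by positivity) ht0]
          have := mul_nonneg (sq_nonneg C) ht0.le
          nlinarith [mul_nonneg (sq_nonneg C) (by positivity : (0 : ℝ) ≤ t + 1)]
        have h3 : m ^ 2 + 2 * m * R / (t + 1) + C ^ 2 / (t + 1) ^ 2 + C ^ 2 / (t + 1) +
            -(2 * m / (t + 1)) * D =
            m ^ 2 - 2 / (t + 1) * (m * (D - R)) + (C ^ 2 / (t + 1) ^ 2 + C ^ 2 / (t + 1)) := by
          ring
        rw [h3]
        have h4 : 0 ≤ 2 / ((t : ℝ) + 1) * (m * (D - R)) := mul_nonneg (by positivity) h1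
        linarith)] with ω hω
  obtain ⟨c, hc⟩ := hω
  exact ⟨c - 0, (hc.sub (tendsto_const_div_atTop_nhds_zero_nat (C ^ 2))).congr fun t =>
    add_sub_cancel_right _ _⟩

end AlmostSure

/-! ### Deterministic growth: from relative drift to powers of t. -/

section Growth

theorem exists_sum_Ico_le_of_eventually_nonpos {h : ℕ → ℝ} (hh : ∀ᶠ s in atTop, h s ≤ 0) :
    ∃ K, ∀ t, ∑ s ∈ Finset.Ico 1 t, h s ≤ K := by
  obtain ⟨s₀, hs₀⟩ := eventually_atTop.1 hh
  refine ⟨∑ s ∈ Finset.range s₀, |h s|, fun t => ?_⟩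
  calc ∑ s ∈ Finset.Ico 1 t, h s
      ≤ ∑ s ∈ Finset.Ico 1 t, if s ∈ Finset.range s₀ then |h s| else 0 := by
        refine Finset.sum_le_sum fun s _ => ?_
        split_ifs with hs
        · exact le_abs_self _
        · exact hs₀ s (by simpa using hs)
    _ = ∑ s ∈ Finset.Ico 1 t ∩ Finset.range s₀, |h s| := by
        rw [Finset.sum_ite_mem]
    _ ≤ ∑ s ∈ Finset.range s₀, |h s| :=
        Finset.sum_le_sum_of_subset_of_nonneg Finset.inter_subset_right fun _ _ _ => abs_nonneg _

theorem log_le_sum_Ico_inv {t : ℕ} (ht : 1 ≤ t) :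
    Real.log t ≤ ∑ s ∈ Finset.Ico 1 t, (s : ℝ)⁻¹ := by
  induction t, ht using Nat.le_induction with
  | base => simp
  | succ t ht ih =>
    rw [Finset.sum_Ico_succ_top ht]
    have ht0 : (0 : ℝ) < t := by positivity
    have h1 := Real.log_le_sub_one_of_pos (by positivity : (0 : ℝ) < (t + 1) / t)
    rw [Real.log_div (by positivity) ht0.ne', add_div, div_self ht0.ne', one_div] at h1
    push_cast
    linarith

theorem sum_Ico_inv_le {t : ℕ} (ht : 1 ≤ t) :
    ∑ s ∈ Finset.Ico 1 t, (s : ℝ)⁻¹ ≤ 1 + Real.log t := by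
  have key : ∑ s ∈ Finset.Ico 1 (t + 1), (s : ℝ)⁻¹ ≤ 1 + Real.log t := by
    induction t, ht using Nat.le_induction with
    | base => simp
    | succ t ht ih =>
      rw [Finset.sum_Ico_succ_top (by omega)]
      have ht0 : (0 : ℝ) < t := by positivity
      have h1 := Real.log_le_sub_one_of_pos (by positivity : (0 : ℝ) < t / (t + 1))
      rw [Real.log_div ht0.ne' (by positivity)] at h1
      have h2 : (t : ℝ) / (t + 1) = 1 - (t + 1 : ℝ)⁻¹ := by
        field_simp
        ring
      push_cast
      linarith
  rw [Finset.sum_Ico_succ_top ht] at key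
  have : 0 ≤ (t : ℝ)⁻¹ := by positivity
  linarith

variable {X D : ℕ → ℝ} {x₀ C κ K c : ℝ}

/-- The harmonic sum is at least log t, and the finitely many exceptional terms only change the
constant. -/
theorem exists_rpow_le_of_eventually_div_le {g : ℕ → ℝ} (hκ : 0 < κ)
    (hX : ∀ t, κ * Real.exp (∑ s ∈ Finset.Ico 1 t, g s) ≤ X t) (hc : 0 ≤ c)
    (hg : ∀ᶠ s : ℕ in atTop, c * (s : ℝ)⁻¹ ≤ g s) :
    ∃ κ', 0 < κ' ∧ ∀ t : ℕ, 1 ≤ t → κ' * (t : ℝ) ^ c ≤ X t := by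
  obtain ⟨K, hK⟩ := exists_sum_Ico_le_of_eventually_nonpos
    (h := fun s : ℕ => c * (s : ℝ)⁻¹ - g s) (hg.mono fun s hs => sub_nonpos.2 hs)
  refine ⟨κ * Real.exp (-K), by positivity, fun t ht => le_trans ?_ (hX t)⟩
  have h1 := hK t
  rw [Finset.sum_sub_distrib, ← Finset.mul_sum] at h1
  have h2 := mul_le_mul_of_nonneg_left (log_le_sum_Ico_inv ht) hc
  rw [Real.rpow_def_of_pos (by positivity), mul_assoc, ← Real.exp_add]
  gcongr
  linarith

/-- Growth at least like `t ^ c'` for every `c' < c` when the drift is at least `c X / t`. -/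
theorem exists_rpow_le (hx₀ : 0 < x₀) (hX₀ : ∀ t, x₀ ≤ X t) (hC : 0 ≤ C) (hκ : 0 < κ)
    (hX : ∀ t, κ * Real.exp (∑ s ∈ Finset.Ico 1 t, D s / (X s + C)) ≤ X t) (hc : 0 < c)
    (hD : ∀ᶠ s : ℕ in atTop, c * (X s / s) ≤ D s) {c' : ℝ} (hc' : 0 ≤ c') (hcc' : c' < c) :
    ∃ κ', 0 < κ' ∧ ∀ t : ℕ, 1 ≤ t → κ' * (t : ℝ) ^ c' ≤ X t := by
  have hpos : ∀ t, 0 < X t := fun t => hx₀.trans_le (hX₀ t)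
  have step : ∀ a : ℝ, 0 ≤ a → (∀ᶠ s in atTop, a * (X s + C) ≤ c * X s) →
      ∃ κ', 0 < κ' ∧ ∀ t : ℕ, 1 ≤ t → κ' * (t : ℝ) ^ a ≤ X t := by
    intro a ha h
    refine exists_rpow_le_of_eventually_div_le hκ hX ha ?_
    filter_upwards [h, hD, eventually_ge_atTop 1] with s h1 h2 h3
    have hs : (0 : ℝ) < s := by positivity
    rw [le_div_iff₀ (by linarith [hpos s])]
    refine le_trans ?_ h2
    rw [mul_right_comm, mul_div_assoc', div_eq_mul_inv]
    gcongr
  -- Bootstrap: X ≥ x₀ alone yields the exponent c x₀/(x₀ + C) > 0, hence X → ∞; then C is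
  -- negligible against X and every exponent below c is reached.
  have htop : Tendsto X atTop atTop := by
    have ha : 0 < c * x₀ / (x₀ + C) := by positivity
    obtain ⟨κ', hκ', h⟩ := step _ ha.le (Eventually.of_forall fun s => by
      rw [div_mul_eq_mul_div, div_le_iff₀ (by positivity)]
      nlinarith [mul_le_mul_of_nonneg_left (hX₀ s) (mul_nonneg hc.le hC)])
    refine tendsto_atTop_mono' atTop ((eventually_ge_atTop 1).mono h) ?_
    exact ((tendsto_rpow_atTop ha).comp tendsto_natCast_atTop_atTop).const_mul_atTop hκ'
  refine step c' hc' ?_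
  filter_upwards [htop.eventually_ge_atTop (c' * C / (c - c'))] with s hs
  rw [div_le_iff₀ (sub_pos.2 hcc')] at hs
  linarith

/-- Growth at most like `t ^ c` when the drift is at most `c X / t`. -/
theorem exists_le_rpow (hpos : ∀ t, 0 < X t) (hK : 0 < K)
    (hX : ∀ t, X t ≤ K * Real.exp (∑ s ∈ Finset.Ico 1 t, D s / X s)) (hc : 0 ≤ c)
    (hD : ∀ᶠ s : ℕ in atTop, D s ≤ c * (X s / s)) :
    ∃ K', 0 < K' ∧ ∀ t : ℕ, 1 ≤ t → X t ≤ K' * (t : ℝ) ^ c := by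
  obtain ⟨L, hL⟩ := exists_sum_Ico_le_of_eventually_nonpos
    (h := fun s : ℕ => D s / X s - c * (s : ℝ)⁻¹) (hD.mono fun s hs => by
      rw [sub_nonpos, div_le_iff₀ (hpos s)]
      refine hs.trans_eq ?_
      ring)
  refine ⟨K * Real.exp (L + c), by positivity, fun t ht => (hX t).trans ?_⟩
  have h1 := hL t
  rw [Finset.sum_sub_distrib, ← Finset.mul_sum] at h1
  have h2 := mul_le_mul_of_nonneg_left (sum_Ico_inv_le ht) hc
  rw [Real.rpow_def_of_pos (by positivity), mul_assoc, ← Real.exp_add]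
  gcongr
  linarith

end Growth

/-! ### Perron–Frobenius theory through the symmetrized matrix. -/

namespace OpinionModel

variable {n : ℕ} (N : OpinionModel n)

/-- The symmetric matrix `(Γ D⁻¹)^(1/2) A (Γ D⁻¹)^(1/2)`, which is similar to `Γ W`. -/
def symmΓW : Matrix (Fin n) (Fin n) ℝ :=
  Matrix.of fun i j => √(N.γ i / N.deg i) * N.a i j * √(N.γ j / N.deg j)

theorem γ_div_deg_pos (i : Fin n) : 0 < N.γ i / N.deg i := div_pos (N.γ_pos i) (N.deg_pos i)

/-- Multiplication by the diagonal of √(γ/deg) carries `y` to a right eigenvector of ΓW for the same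
eigenvalue. -/
theorem le_lambdaMax_of_mulVec_symmΓW {y : Fin n → ℝ} (hy : y ≠ 0) {μ : ℝ}
    (h : N.symmΓW.mulVec y = μ • y) : μ ≤ lambdaMax N.ΓW := by
  refine le_csSup (Module.End.finite_hasEigenvalue _).bddAbove ?_
  refine Module.End.hasEigenvalue_of_hasEigenvector
    (x := fun i => √(N.γ i / N.deg i) * y i) (Module.End.hasEigenvector_iff.2 ⟨?_, ?_⟩)
  · rw [Module.End.mem_eigenspace_iff, Matrix.toLin'_apply]
    funext i
    have h1 := congrFun h i
    simp only [Matrix.mulVec, dotProduct, symmΓW, Matrix.of_apply, Pi.smul_apply,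
      smul_eq_mul] at h1 ⊢
    rw [mul_left_comm, ← h1, Finset.mul_sum]
    refine Finset.sum_congr rfl fun j _ => ?_
    have h2 := Real.mul_self_sqrt (N.γ_div_deg_pos i).le
    rw [ΓW_apply, W_apply, ← mul_assoc (N.γ i), ← div_eq_mul_inv]
    generalize √(N.γ i / N.deg i) = r at *
    rw [← h2]
    ring
  · contrapose! hy
    funext i
    have h1 := congrFun hy i
    exact (mul_eq_zero.1 h1).resolve_left (Real.sqrt_pos.2 (N.γ_div_deg_pos i)).ne'

theorem symmΓW_comm (i j : Fin n) : N.symmΓW i j = N.symmΓW j i := by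
  simp only [symmΓW, Matrix.of_apply]
  rw [a_comm]
  ring

theorem symmΓW_nonneg (i j : Fin n) : 0 ≤ N.symmΓW i j :=
  mul_nonneg (mul_nonneg (Real.sqrt_nonneg _) (N.a_nonneg i j)) (Real.sqrt_nonneg _)

theorem symmΓW_pos {i j : Fin n} (h : 0 < N.W i j) : 0 < N.symmΓW i j := by
  rw [W_apply] at h
  exact mul_pos (mul_pos (Real.sqrt_pos.2 (N.γ_div_deg_pos i))
    (pos_of_mul_pos_right h (inv_nonneg.2 (N.deg_nonneg i))))
    (Real.sqrt_pos.2 (N.γ_div_deg_pos j))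

theorem posSemidef_lambdaMax_sub_symmΓW :
    (lambdaMax N.ΓW • (1 : Matrix (Fin n) (Fin n) ℝ) - N.symmΓW).PosSemidef := by
  have hH : (lambdaMax N.ΓW • (1 : Matrix (Fin n) (Fin n) ℝ) - N.symmΓW).IsHermitian := by
    ext i j
    simp [Matrix.sub_apply, Matrix.one_apply, eq_comm (a := i), N.symmΓW_comm i j]
  rw [hH.posSemidef_iff_eigenvalues_nonneg]
  intro k
  have h1 := hH.mulVec_eigenvectorBasis k
  have h2 : (hH.eigenvectorBasis k).ofLp ≠ 0 := fun h =>
    hH.eigenvectorBasis.orthonormal.ne_zero k (WithLp.ofLp_injective 2 h)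
  rw [Matrix.sub_mulVec, Matrix.smul_mulVec, Matrix.one_mulVec] at h1
  have h3 := N.le_lambdaMax_of_mulVec_symmΓW h2 (μ := lambdaMax N.ΓW - hH.eigenvalues k) (by
    rw [sub_smul, ← h1]
    abel)
  simpa using h3

/-- At a zero entry a sum of nonnegative terms vanishes, so all neighbouring entries are zero;
irreducibility spreads this. -/
theorem symmΓW_nonneg_eigenvector_eq_zero {z : Fin n → ℝ} (hz : ∀ i, 0 ≤ z i) {μ : ℝ}
    (h : N.symmΓW.mulVec z = μ • z) {i : Fin n} (hi : z i = 0) : z = 0 := by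
  funext j
  refine N.forall_of_neighbour (Q := fun j => z j = 0) (fun k l hkl hk => ?_) hi j
  have h1 := congrFun h k
  simp only [Matrix.mulVec, dotProduct, Pi.smul_apply, smul_eq_mul, hk, mul_zero] at h1
  rw [Finset.sum_eq_zero_iff_of_nonneg fun m _ => mul_nonneg (N.symmΓW_nonneg k m) (hz m)] at h1
  exact (mul_eq_zero.1 (h1 l (Finset.mem_univ l))).resolve_left (N.symmΓW_pos hkl).ne'

/-- Entries being nonnegative, |y| has a Rayleigh quotient no smaller than that of `y`, which is
already maximal. So |y| annihilates a positive semidefinite form and lies in its kernel. -/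
theorem symmΓW_mulVec_abs {y : Fin n → ℝ} (h : N.symmΓW.mulVec y = lambdaMax N.ΓW • y) :
    N.symmΓW.mulVec |y| = lambdaMax N.ΓW • |y| := by
  have hP := N.posSemidef_lambdaMax_sub_symmΓW
  have h1 := (hP.dotProduct_mulVec_zero_iff |y|).1 (le_antisymm ?_ (hP.dotProduct_mulVec_nonneg _))
  · rw [Matrix.sub_mulVec, Matrix.smul_mulVec, Matrix.one_mulVec, sub_eq_zero] at h1
    exact h1.symm
  · have h2 : y ⬝ᵥ N.symmΓW.mulVec y ≤ |y| ⬝ᵥ N.symmΓW.mulVec |y| := by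
      simp only [dotProduct, Matrix.mulVec, Finset.mul_sum, Pi.abs_apply]
      refine Finset.sum_le_sum fun i _ => Finset.sum_le_sum fun j _ => ?_
      refine (le_abs_self _).trans_eq ?_
      rw [abs_mul, abs_mul, abs_of_nonneg (N.symmΓW_nonneg i j)]
    have h3 : |y| ⬝ᵥ |y| = y ⬝ᵥ y := by
      simp [dotProduct]
    rw [h, dotProduct_smul] at h2
    rw [star_trivial, Matrix.sub_mulVec, Matrix.smul_mulVec, Matrix.one_mulVec, dotProduct_sub,
      dotProduct_smul, h3]
    linarith

variable {N} {v : Fin n → ℝ}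

theorem sum_mul_ΓW (hv : Matrix.vecMul v N.ΓW = lambdaMax N.ΓW • v) (j : Fin n) :
    ∑ i, v i * (N.γ i * N.W i j) = lambdaMax N.ΓW * v j := by
  simpa [Matrix.vecMul, dotProduct, ΓW_apply] using congrFun hv j

/-- The left eigenvector of `Γ W` for its largest eigenvalue is positive. -/
theorem eigenvector_pos (hv : Matrix.vecMul v N.ΓW = lambdaMax N.ΓW • v) (hv1 : ∑ i, v i = 1)
    (i : Fin n) : 0 < v i := by
  set y : Fin n → ℝ := fun i => √(N.γ i / N.deg i) * v i
  have hs : ∀ i, 0 < √(N.γ i / N.deg i) := fun i => Real.sqrt_pos.2 (N.γ_div_deg_pos i)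
  have hy : N.symmΓW.mulVec y = lambdaMax N.ΓW • y := by
    funext j
    simp only [Matrix.mulVec, dotProduct, Pi.smul_apply, smul_eq_mul, y]
    rw [mul_left_comm, ← sum_mul_ΓW hv j, Finset.mul_sum]
    refine Finset.sum_congr rfl fun k _ => ?_
    have h2 := Real.mul_self_sqrt (N.γ_div_deg_pos k).le
    simp only [symmΓW, Matrix.of_apply]
    rw [W_apply, ← mul_assoc (N.γ k), ← div_eq_mul_inv, N.a_comm k j]
    generalize √(N.γ k / N.deg k) = r at *
    rw [← h2]
    ring
  obtain ⟨k, -, hk⟩ : ∃ k ∈ Finset.univ, 0 < v k := by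
    by_contra! h
    linarith [Finset.sum_nonpos h]
  have hyk : 0 < y k := mul_pos (hs k) hk
  have habs := N.symmΓW_mulVec_abs hy
  -- A nonnegative eigenvector that vanishes at `k`, where y > 0; the normalization of `v` supplied
  -- this `k`.
  have h1 : |y| - y = 0 := by
    refine N.symmΓW_nonneg_eigenvector_eq_zero (μ := lambdaMax N.ΓW)
      (fun i => sub_nonneg.2 (le_abs_self (y i))) ?_ (i := k) ?_
    · rw [Matrix.mulVec_sub, habs, hy, smul_sub]
    · simp [abs_of_pos hyk]
  have hy0 : ∀ i, 0 ≤ y i := fun i => by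
    have := congrFun h1 i
    simp only [Pi.sub_apply, Pi.abs_apply, Pi.zero_apply, sub_eq_zero] at this
    rw [← this]
    exact abs_nonneg _
  refine pos_of_mul_pos_right ((hy0 i).lt_of_ne fun h => ?_) (hs i).le
  have := N.symmΓW_nonneg_eigenvector_eq_zero hy0 hy h.symm
  exact hyk.ne' (congrFun this k)

theorem lambdaMax_pos (hv : Matrix.vecMul v N.ΓW = lambdaMax N.ΓW • v) (hv1 : ∑ i, v i = 1) :
    0 < lambdaMax N.ΓW := by
  have hpos := eigenvector_pos hv hv1
  obtain ⟨j, -, hj⟩ : ∃ j ∈ Finset.univ, 0 < v j := by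
    by_contra! h
    linarith [Finset.sum_nonpos h]
  refine pos_of_mul_pos_left ?_ (hpos j).le
  rw [← sum_mul_ΓW hv j]
  obtain ⟨i, hi⟩ := N.exists_neighbour j
  exact Finset.sum_pos'
    (fun i _ => mul_nonneg (hpos i).le (mul_nonneg (N.γ_pos i).le (N.W_nonneg i j)))
    ⟨i, Finset.mem_univ i, mul_pos (hpos i) (mul_pos (N.γ_pos i) hi)⟩

end OpinionModel

theorem sum_mul_tally {n : ℕ} (v x₀ : Fin n → ℝ) (g : Bool → ℝ) (t : ℕ)
    (p : ℕ → Fin n → Bool) :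
    ∑ i, v i * tally (x₀ i) (fun x => g (x i)) t p =
      tally (∑ i, v i * x₀ i) (fun x => ∑ i, v i * g (x i)) t p := by
  simp only [tally, mul_add, Finset.sum_add_distrib, Finset.mul_sum]
  rw [Finset.sum_comm]

theorem div_one_add_lt_div_one_add {s y : ℝ} (hs : 0 ≤ s) (hsy : s < y) :
    s / (1 + s) < y / (1 + y) := by
  rw [div_lt_div_iff₀ (by linarith) (by linarith)]
  linarith

/-- Jensen's inequality for the concave function `s ↦ s / (1 + s)`. -/
theorem sum_mul_div_one_add_le {ι : Type*} [Fintype ι] {w s : ι → ℝ} (hw : ∀ j, 0 ≤ w j)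
    (hw1 : ∑ j, w j = 1) (hs : ∀ j, 0 ≤ s j) :
    ∑ j, w j * (s j / (1 + s j)) ≤ (∑ j, w j * s j) / (1 + ∑ j, w j * s j) := by
  set y := ∑ j, w j * s j
  have hy : 0 ≤ y := Finset.sum_nonneg fun j _ => mul_nonneg (hw j) (hs j)
  -- Tangent line at the mean y.
  have h1 : ∀ r : ℝ, 0 ≤ r → r / (1 + r) ≤ y / (1 + y) + (r - y) / (1 + y) ^ 2 := by
    intro r hr
    have h2 : y / (1 + y) + (r - y) / (1 + y) ^ 2 - r / (1 + r) =
        (r - y) ^ 2 / ((1 + y) ^ 2 * (1 + r)) := by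
      field_simp
      ring
    have h3 : 0 ≤ (r - y) ^ 2 / ((1 + y) ^ 2 * (1 + r)) := by positivity
    linarith
  calc ∑ j, w j * (s j / (1 + s j))
      ≤ ∑ j, w j * (y / (1 + y) + (s j - y) / (1 + y) ^ 2) :=
        Finset.sum_le_sum fun j _ => mul_le_mul_of_nonneg_left (h1 _ (hs j)) (hw j)
    _ = (∑ j, w j) * (y / (1 + y)) + (∑ j, w j * s j - (∑ j, w j) * y) / (1 + y) ^ 2 := by
        simp only [mul_add, Finset.sum_add_distrib, mul_div_assoc', mul_sub, Finset.sum_mul,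
          ← Finset.sum_div, Finset.sum_sub_distrib]
    _ = y / (1 + y) := by
        rw [hw1, one_mul, one_mul, sub_self, zero_div, add_zero]

namespace OpinionModel

variable {n : ℕ} {N : OpinionModel n} {v : Fin n → ℝ}

theorem div_le_declareProb {μ γ η : ℝ} (hγ : 0 < γ) (h0 : 0 < μ) (h1 : μ < 1) (h : γ * μ ≤ η) :
    γ * μ / (1 + η) ≤ declareProb μ γ := by
  refine le_trans ?_ (le_declareProb hγ h0 h1)
  have := mul_pos hγ h0
  gcongr

theorem one_sub_prob_eq (i : Fin n) {t : ℕ} (ht : 1 ≤ t) (p : ℕ → Fin n → Bool) :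
    1 - N.prob i t p = declareProb (1 - N.observed p t i) (N.γ i)⁻¹ :=
  one_sub_declareProb (N.γ_pos i) (N.observed_pos p ht i) (N.observed_lt_one p ht i)

theorem sum_mul_sum_W (c y : Fin n → ℝ) :
    ∑ i, c i * ∑ j, N.W i j * y j = ∑ j, (∑ i, c i * N.W i j) * y j := by
  simp only [Finset.mul_sum, Finset.sum_mul]
  rw [Finset.sum_comm]
  exact Finset.sum_congr rfl fun j _ => Finset.sum_congr rfl fun i _ => by ring

/-- A left sub-eigenvector of `Γ⁻¹ W` for `λ⁻¹`, built from the left eigenvector of `Γ W`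
for `λ`. -/
theorem le_lambdaMax_mul_sum (hv : Matrix.vecMul v N.ΓW = lambdaMax N.ΓW • v)
    (hpos : ∀ i, 0 < v i) (j : Fin n) :
    N.deg j ^ 2 / v j ≤
      lambdaMax N.ΓW * ∑ i, N.deg i ^ 2 / v i * (N.γ i)⁻¹ * N.W i j := by
  -- Cauchy–Schwarz: the factors `f i` and `g i` multiply to (a i j)². The sum of `g` is λ v j, and
  -- by symmetry the column sum of `a` is deg j.
  have h1 := Finset.sum_sq_le_sum_mul_sum_of_sq_le_mul Finset.univ (r := fun i => N.a i j)
    (f := fun i => N.deg i ^ 2 / v i * (N.γ i)⁻¹ * N.W i j)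
    (g := fun i => v i * (N.γ i * N.W i j))
    (fun i _ => mul_nonneg (mul_nonneg (div_nonneg (sq_nonneg _) (hpos i).le)
      (inv_nonneg.2 (N.γ_pos i).le)) (N.W_nonneg i j))
    (fun i _ => mul_nonneg (hpos i).le (mul_nonneg (N.γ_pos i).le (N.W_nonneg i j)))
    (fun i _ => by
      have := (hpos i).ne'
      have := (N.γ_pos i).ne'
      have := (N.deg_pos i).ne'
      refine le_of_eq ?_
      rw [W_apply]
      field_simp)
  rw [sum_mul_ΓW hv, show ∑ i, N.a i j = N.deg j from
    Finset.sum_congr rfl fun i _ => N.a_comm i j] at h1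
  rw [div_le_iff₀ (hpos j)]
  linarith

/-- The right eigenvector of `Γ W`. -/
theorem γ_mul_sum_W (hv : Matrix.vecMul v N.ΓW = lambdaMax N.ΓW • v) (i : Fin n) :
    N.γ i * ∑ j, N.W i j * (v j * N.γ j / N.deg j) =
      lambdaMax N.ΓW * (v i * N.γ i / N.deg i) := by
  have h : lambdaMax N.ΓW * (v i * N.γ i / N.deg i) =
      lambdaMax N.ΓW * v i * (N.γ i / N.deg i) := by ring
  rw [h, ← sum_mul_ΓW hv i, Finset.mul_sum, Finset.sum_mul]
  refine Finset.sum_congr rfl fun j _ => ?_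
  rw [W_apply, W_apply, N.a_comm i j]
  ring

/-! ### Instability of consensus to 1. -/

section Zeros

/-- The weights of the functional that detects the instability of consensus to `1`. -/
def zeroWeight (N : OpinionModel n) (v : Fin n → ℝ) (i : Fin n) : ℝ := N.deg i ^ 2 / v i

theorem zeroWeight_pos (hpos : ∀ i, 0 < v i) (i : Fin n) : 0 < N.zeroWeight v i :=
  div_pos (pow_pos (N.deg_pos i) 2) (hpos i)

/-- The weighted number of declarations of `0`. -/
def weightedZeros (N : OpinionModel n) (v : Fin n → ℝ) : ℕ → (ℕ → Fin n → Bool) → ℝ :=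
  tally (∑ i, N.zeroWeight v i * (1 - N.b i))
    fun x => ∑ i, N.zeroWeight v i * (1 - opinionValue (x i))

theorem weightedZeros_eq (t : ℕ) (p : ℕ → Fin n → Bool) :
    N.weightedZeros v t p = ∑ i, N.zeroWeight v i * N.zeros i t p :=
  (sum_mul_tally (N.zeroWeight v) (fun i => 1 - N.b i) (fun o => 1 - opinionValue o) t p).symm

theorem drift_weightedZeros (t : ℕ) (p : ℕ → Fin n → Bool) :
    N.drift (fun x => ∑ i, N.zeroWeight v i * (1 - opinionValue (x i))) t p =
      ∑ i, N.zeroWeight v i * (1 - N.prob i t p) := by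
  rw [N.drift_sum (N.zeroWeight v) fun o => 1 - opinionValue o]
  simp [opinionValue]

/-- When 0s are rare, the chance of declaring 0 is almost linear, given by Γ⁻¹W up to a factor 1 +
η; the weights form a left sub-eigenvector for λ⁻¹ > 1. -/
theorem exists_mul_le_drift_weightedZeros (hv : Matrix.vecMul v N.ΓW = lambdaMax N.ΓW • v)
    (hpos : ∀ i, 0 < v i) (hlam0 : 0 < lambdaMax N.ΓW) (hlam : lambdaMax N.ΓW < 1) :
    ∃ δ ρ : ℝ, 0 < δ ∧ 1 < ρ ∧ ∀ t p, 1 ≤ t → N.weightedZeros v t p / t < δ →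
      ρ * (N.weightedZeros v t p / t) ≤
        N.drift (fun x => ∑ i, N.zeroWeight v i * (1 - opinionValue (x i))) t p := by
  set l := lambdaMax N.ΓW
  have hz := zeroWeight_pos (N := N) hpos
  -- Chosen so that λ(1 + η) is the midpoint of λ and 1, leaving ρ > 1.
  set η : ℝ := (1 - l) / (2 * l)
  have hη : 0 < η := div_pos (by linarith) (by linarith)
  have hlη : l * (1 + η) = (1 + l) / 2 := by
    simp only [η]
    field_simp
    ring
  set B : ℝ := ∑ i, (N.γ i)⁻¹ * ∑ j, N.W i j * (N.zeroWeight v j)⁻¹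
  have hterm : ∀ i, 0 ≤ (N.γ i)⁻¹ * ∑ j, N.W i j * (N.zeroWeight v j)⁻¹ := fun i =>
    mul_nonneg (inv_nonneg.2 (N.γ_pos i).le) (Finset.sum_nonneg fun j _ =>
      mul_nonneg (N.W_nonneg i j) (inv_nonneg.2 (hz j).le))
  have hB : 0 ≤ B := Finset.sum_nonneg fun i _ => hterm i
  have hlη1 : 0 < l * (1 + η) := by positivity
  refine ⟨η / (1 + B), (l * (1 + η))⁻¹, by positivity,
    (one_lt_inv₀ hlη1).2 (by linarith), fun t p ht hR => ?_⟩
  have ht0 : (0 : ℝ) < t := by positivity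
  have hη' : ∀ i, (N.γ i)⁻¹ * (1 - N.observed p t i) ≤ η := by
    intro i
    have h1 : ∀ j, N.zeros j t p / t ≤ η / (1 + B) * (N.zeroWeight v j)⁻¹ := by
      intro j
      rw [← div_eq_mul_inv, le_div_iff₀ (hz j), mul_comm, mul_div_assoc']
      refine le_trans ?_ hR.le
      rw [weightedZeros_eq]
      gcongr
      exact Finset.single_le_sum (f := fun j => N.zeroWeight v j * N.zeros j t p)
        (fun k _ => mul_nonneg (hz k).le (N.zeros_pos k t p).le) (Finset.mem_univ j)
    calc (N.γ i)⁻¹ * (1 - N.observed p t i)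
        = (N.γ i)⁻¹ * ∑ j, N.W i j * (N.zeros j t p / t) := by
          rw [one_sub_observed_eq N p ht, Finset.sum_div]
          simp only [mul_div_assoc]
      _ ≤ (N.γ i)⁻¹ * ∑ j, N.W i j * (η / (1 + B) * (N.zeroWeight v j)⁻¹) :=
          mul_le_mul_of_nonneg_left (Finset.sum_le_sum fun j _ =>
            mul_le_mul_of_nonneg_left (h1 j) (N.W_nonneg i j)) (inv_nonneg.2 (N.γ_pos i).le)
      _ = η / (1 + B) * ((N.γ i)⁻¹ * ∑ j, N.W i j * (N.zeroWeight v j)⁻¹) := by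
          simp only [mul_left_comm _ (η / (1 + B)), ← Finset.mul_sum]
      _ ≤ η / (1 + B) * (1 + B) := by
          gcongr
          have := Finset.single_le_sum (fun k _ => hterm k) (Finset.mem_univ i)
          linarith
      _ = η := div_mul_cancel₀ _ (by positivity)
  rw [drift_weightedZeros, inv_mul_le_iff₀ hlη1, weightedZeros_eq, Finset.sum_div]
  calc ∑ j, N.zeroWeight v j * N.zeros j t p / t
      ≤ ∑ j, l * ((∑ i, N.zeroWeight v i * (N.γ i)⁻¹ * N.W i j) * (N.zeros j t p / t)) := by
        refine Finset.sum_le_sum fun j _ => ?_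
        rw [mul_div_assoc, ← mul_assoc]
        exact mul_le_mul_of_nonneg_right (le_lambdaMax_mul_sum hv hpos j)
          (div_nonneg (N.zeros_pos j t p).le ht0.le)
    _ = l * ∑ i, N.zeroWeight v i * ((N.γ i)⁻¹ * (1 - N.observed p t i)) := by
        rw [← Finset.mul_sum, ← sum_mul_sum_W]
        congr 1
        refine Finset.sum_congr rfl fun i _ => ?_
        rw [one_sub_observed_eq N p ht, Finset.sum_div, mul_assoc]
        simp only [mul_div_assoc]
    _ ≤ l * ∑ i, N.zeroWeight v i * ((1 + η) * (1 - N.prob i t p)) := by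
        refine mul_le_mul_of_nonneg_left (Finset.sum_le_sum fun i _ =>
          mul_le_mul_of_nonneg_left ?_ (hz i).le) hlam0.le
        rw [one_sub_prob_eq i ht, mul_comm (1 + η), ← div_le_iff₀ (by positivity)]
        exact div_le_declareProb (inv_pos.2 (N.γ_pos i))
          (sub_pos.2 (N.observed_lt_one p ht i)) (by linarith [N.observed_pos p ht i]) (hη' i)
    _ = l * (1 + η) * ∑ i, N.zeroWeight v i * (1 - N.prob i t p) := by
        simp only [Finset.mul_sum]
        exact Finset.sum_congr rfl fun i _ => by ring

/-- The proportion of declarations of `0` does not vanish. -/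
theorem ae_eventually_le_weightedZeros {Ω : Type*} [MeasurableSpace Ω] {P : Measure Ω}
    [IsProbabilityMeasure P] {ψ : ℕ → Ω → Fin n → Bool} (hψ : IsOpinionProcess N P ψ)
    (hn : Nonempty (Fin n)) (hv : Matrix.vecMul v N.ΓW = lambdaMax N.ΓW • v)
    (hpos : ∀ i, 0 < v i) (hlam0 : 0 < lambdaMax N.ΓW) (hlam : lambdaMax N.ΓW < 1) :
    ∀ᵐ ω ∂P, ∃ η : ℝ, 0 < η ∧
      ∀ᶠ t : ℕ in atTop, η ≤ N.weightedZeros v t (fun τ => ψ τ ω) / t := by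
  obtain ⟨δ, ρ, hδ, hρ, h⟩ := exists_mul_le_drift_weightedZeros hv hpos hlam0 hlam
  have hz := zeroWeight_pos (N := N) hpos
  set x₀ : ℝ := ∑ i, N.zeroWeight v i * (1 - N.b i)
  set C : ℝ := ∑ i, N.zeroWeight v i
  set ξ : (Fin n → Bool) → ℝ := fun x => ∑ i, N.zeroWeight v i * (1 - opinionValue (x i))
  have hx₀ : 0 < x₀ := Finset.sum_pos
    (fun i _ => mul_pos (hz i) (sub_pos.2 (N.b_lt_one i))) Finset.univ_nonempty
  have hC : 0 ≤ C := Finset.sum_nonneg fun i _ => (hz i).le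
  have hx₀C : x₀ ≤ C := Finset.sum_le_sum fun i _ =>
    mul_le_of_le_one_right (hz i).le (by linarith [N.b_pos i])
  have hξ : ∀ x, 0 ≤ ξ x := fun x => Finset.sum_nonneg fun i _ =>
    mul_nonneg (hz i).le (sub_nonneg.2 (opinionValue_le_one _))
  have hξC : ∀ x, ξ x ≤ C := fun x => Finset.sum_le_sum fun i _ =>
    mul_le_of_le_one_right (hz i).le (by linarith [opinionValue_nonneg (x i)])
  filter_upwards [ae_exp_le_tally hψ hx₀ hξ hξC, ae_tendsto_truncation hψ hx₀ hx₀C hξ hξC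
    (δ := δ) fun t p ht hR => le_trans (le_mul_of_one_le_left
      (div_nonneg (hx₀.le.trans (le_tally hξ t p)) (Nat.cast_nonneg t)) hρ.le) (h t p ht hR)]
    with ω h1 h2
  obtain ⟨κ, hκ, h1⟩ := h1
  obtain ⟨c, hc⟩ := h2
  have hc0 : 0 ≤ c := ge_of_tendsto' hc fun t => sq_nonneg _
  -- A positive limit would keep the proportion below δ from some time on. The count would then grow
  -- like t^((1 + ρ)/2), faster than linearly, a contradiction.
  have hc1 : c = 0 := by
    by_contra hne
    have hlt : ∀ᶠ t : ℕ in atTop, N.weightedZeros v t (fun τ => ψ τ ω) / t < δ := by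
      filter_upwards [hc.eventually_const_lt (hc0.lt_of_ne' hne)] with t ht
      by_contra! hle
      rw [weightedZeros] at hle
      rw [max_eq_right (sub_nonpos.2 hle)] at ht
      simp at ht
    obtain ⟨κ', hκ', hgrow⟩ := exists_rpow_le (c' := (1 + ρ) / 2) hx₀
      (fun t => le_tally hξ t fun τ => ψ τ ω) hC hκ h1
      (by linarith : 0 < ρ)
      ((hlt.and (eventually_ge_atTop 1)).mono fun t ht => h t _ ht.2 ht.1)
      (by linarith) (by linarith)
    have htop : Tendsto (fun t : ℕ => κ' * (t : ℝ) ^ ((ρ - 1) / 2)) atTop atTop :=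
      ((tendsto_rpow_atTop (by linarith)).comp tendsto_natCast_atTop_atTop).const_mul_atTop hκ'
    obtain ⟨t, ht1, ht2, ht3⟩ :=
      (hlt.and ((eventually_ge_atTop 1).and (htop.eventually_ge_atTop δ))).exists
    have ht0 : (0 : ℝ) < t := by positivity
    have h4 := hgrow t ht2
    rw [show (1 + ρ) / 2 = (ρ - 1) / 2 + 1 by ring, Real.rpow_add_one ht0.ne', ← mul_assoc,
      ← le_div_iff₀ ht0] at h4
    exact absurd (ht3.trans h4) (not_le.2 ht1)
  rw [hc1] at hc
  refine ⟨δ / 2, by positivity, ?_⟩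
  filter_upwards [hc.eventually_lt_const (by positivity : 0 < (δ / 2) ^ 2)] with t ht
  have h3 := lt_of_pow_lt_pow_left₀ 2 (by positivity) ht
  have h4 := (le_max_left _ _).trans_lt h3
  rw [weightedZeros]
  linarith

end Zeros

/-! ### Every agent keeps declaring 0 with positive frequency. -/

/-- The one-sided law of large numbers for all agents, as a property of a path. -/
def FollowsDrift (N : OpinionModel n) (p : ℕ → Fin n → Bool) : Prop :=
  ∀ i, ∀ ε : ℝ, 0 < ε → ∃ K : ℝ, ∀ t, 1 ≤ t →
    N.ones i t p ≤ ∑ s ∈ Finset.Ico 1 t, N.prob i s p + ε * t + K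

variable {p : ℕ → Fin n → Bool}

/-- Discrete integration of a quantity with increments at most 1: its square grows by at most 2Z + 1
per step. -/
theorem sq_zeros_le (i : Fin n) {t : ℕ} (ht : 1 ≤ t) :
    N.zeros i t p ^ 2 ≤ 2 * ∑ s ∈ Finset.Ico 1 t, N.zeros i s p + t := by
  induction t, ht using Nat.le_induction with
  | base =>
    simp only [zeros, tally_one, Finset.Ico_self, Finset.sum_empty, mul_zero, zero_add,
      Nat.cast_one]
    have := N.b_pos i
    have := N.b_lt_one i
    nlinarith
  | succ t ht ih =>
    have hpos := N.zeros_pos i t p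
    have h1 : N.zeros i (t + 1) p ≤ N.zeros i t p + 1 := by
      unfold zeros
      rw [tally_succ _ _ ht]
      linarith [opinionValue_nonneg (p (t + 1) i)]
    have h2 := pow_le_pow_left₀ (N.zeros_pos i (t + 1) p).le h1 2
    rw [Finset.sum_Ico_succ_top ht]
    push_cast
    linarith

/-- Agent `i` sees the 0s of `j` and imitates them with probability at least proportional to their
frequency. Summing over time bounds the 0s of `i` below by the square of the final frequency of `j`.
-/
theorem FollowsDrift.zeros_ge (hp : N.FollowsDrift p) {i j : Fin n} {ε : ℝ} (hε : 0 < ε) :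
    ∃ K, ∀ t : ℕ, 1 ≤ t → N.W i j / (N.γ i + 1) / 2 * ((N.zeros j t p / t) ^ 2 - 1 / t) ≤
      N.zeros i t p / t + ε + K / t := by
  obtain ⟨K, hK⟩ := hp i ε hε
  refine ⟨K, fun t ht => ?_⟩
  have ht0 : (0 : ℝ) < t := by positivity
  set c : ℝ := N.W i j / (N.γ i + 1)
  have hγ := N.γ_pos i
  have hc : 0 ≤ c := div_nonneg (N.W_nonneg i j) (by linarith)
  have h1 : ∀ s ∈ Finset.Ico 1 t, c * N.zeros j s p / t ≤ 1 - N.prob i s p := by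
    intro s hs
    obtain ⟨hs1, hst⟩ := Finset.mem_Ico.1 hs
    have hs0 : (0 : ℝ) < s := by positivity
    have hν0 : 0 < 1 - N.observed p s i := sub_pos.2 (N.observed_lt_one p hs1 i)
    have hν1 : 1 - N.observed p s i < 1 := by linarith [N.observed_pos p hs1 i]
    have hν : N.W i j * N.zeros j s p / t ≤ 1 - N.observed p s i := by
      rw [one_sub_observed_eq N p hs1]
      have h2 : N.W i j * N.zeros j s p ≤ ∑ k, N.W i k * N.zeros k s p :=
        Finset.single_le_sum (f := fun k => N.W i k * N.zeros k s p)
          (fun k _ => mul_nonneg (N.W_nonneg i k) (N.zeros_pos k s p).le) (Finset.mem_univ j)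
      have h3 : (s : ℝ) ≤ t := by exact_mod_cast hst.le
      exact div_le_div₀ ((mul_nonneg (N.W_nonneg i j) (N.zeros_pos j s p).le).trans h2) h2 hs0 h3
    rw [one_sub_prob_eq i hs1]
    refine le_trans ?_ (div_le_declareProb (η := (N.γ i)⁻¹) (inv_pos.2 hγ) hν0 hν1
      (mul_le_of_le_one_right (inv_nonneg.2 hγ.le) hν1.le))
    have h4 : (N.γ i)⁻¹ * (1 - N.observed p s i) / (1 + (N.γ i)⁻¹) =
        (1 - N.observed p s i) / (N.γ i + 1) := by
      field_simp
    rw [h4]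
    simp only [c]
    rw [div_mul_eq_mul_div, div_right_comm]
    gcongr
  have h2 := Finset.sum_le_sum h1
  rw [← Finset.sum_div, ← Finset.mul_sum, Finset.sum_sub_distrib] at h2
  have h3 : ∑ s ∈ Finset.Ico 1 t, (1 : ℝ) ≤ t := by simp
  have h4 := N.ones_add_zeros i ht p
  have h5 := hK t ht
  have h6 := mul_le_mul_of_nonneg_left (N.sq_zeros_le (p := p) j ht) (div_nonneg hc zero_le_two)
  have h7 : c * ∑ s ∈ Finset.Ico 1 t, N.zeros j s p ≤ t * (N.zeros i t p + ε * t + K) := by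
    rw [← div_le_iff₀' ht0]
    linarith
  have h8 : c / 2 * ((N.zeros j t p / t) ^ 2 - 1 / t) =
      (c / 2 * N.zeros j t p ^ 2 - c / 2 * t) / t ^ 2 := by
    field_simp
  have h9 : N.zeros i t p / t + ε + K / t = t * (N.zeros i t p + ε * t + K) / t ^ 2 := by
    field_simp
  rw [h8, h9]
  gcongr
  linarith

/-- A general filter `F` is allowed because the application is along a subsequence of times. -/
theorem FollowsDrift.tendsto_zeros (hp : N.FollowsDrift p) {i j : Fin n} (hij : 0 < N.W i j)
    {F : Filter ℕ} (hF : F ≤ atTop) (hi : Tendsto (fun t : ℕ => N.zeros i t p / t) F (𝓝 0)) :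
    Tendsto (fun t : ℕ => N.zeros j t p / t) F (𝓝 0) := by
  have hγ := N.γ_pos i
  set c : ℝ := N.W i j / (N.γ i + 1) / 2
  have hc : 0 < c := by positivity
  rw [Metric.tendsto_nhds]
  intro e he
  obtain ⟨K, hK⟩ := hp.zeros_ge (i := i) (j := j) (ε := c * e ^ 2 / 2) (by positivity)
  have h1 : Tendsto (fun t : ℕ => N.zeros i t p / t + c * e ^ 2 / 2 + K / t + c * (1 / t)) F
      (𝓝 (0 + c * e ^ 2 / 2 + 0 + c * 0)) :=
    ((hi.add_const _).add ((tendsto_const_div_atTop_nhds_zero_nat K).mono_left hF)).add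
      (((tendsto_const_div_atTop_nhds_zero_nat 1).mono_left hF).const_mul c)
  have h2 : 0 + c * e ^ 2 / 2 + 0 + c * 0 < c * e ^ 2 := by
    have : 0 < c * e ^ 2 := by positivity
    linarith
  filter_upwards [h1.eventually_lt_const h2, hF (eventually_ge_atTop 1)] with t h3 ht
  have h4 : c * ((N.zeros j t p / t) ^ 2 - 1 / t) ≤ _ := hK t ht
  have h5 : c * (N.zeros j t p / t) ^ 2 < c * e ^ 2 := by
    rw [mul_sub] at h4
    linarith
  have h6 : 0 ≤ N.zeros j t p / t := div_nonneg (N.zeros_pos j t p).le t.cast_nonneg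
  rw [Real.dist_eq, sub_zero, abs_of_nonneg h6]
  exact lt_of_pow_lt_pow_left₀ 2 he.le (lt_of_mul_lt_mul_left h5 hc.le)

theorem FollowsDrift.exists_eventually_le_zeros (hp : N.FollowsDrift p) {η : ℝ} (hη : 0 < η)
    (h : ∀ᶠ t : ℕ in atTop, η ≤ N.weightedZeros v t p / t) (i : Fin n) :
    ∃ η' : ℝ, 0 < η' ∧ ∀ᶠ t : ℕ in atTop, η' ≤ N.zeros i t p / t := by
  by_contra! hcon
  -- The times along which the 0s of `i` become rare. Rarity spreads to all agents, against the
  -- lower bound for the weighted count.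
  set F : Filter ℕ := atTop ⊓ comap (fun t : ℕ => N.zeros i t p / t) (𝓝 0)
  have hne : F.NeBot := by
    rw [Filter.inf_neBot_iff_frequently_right]
    intro q hq
    obtain ⟨e, he, h1⟩ := Metric.eventually_nhds_iff.1 (eventually_comap.1 hq)
    refine (hcon e he).mono fun t ht => h1 ?_ t rfl
    rwa [Real.dist_eq, sub_zero, abs_of_nonneg (div_nonneg (N.zeros_pos i t p).le t.cast_nonneg)]
  have hall : ∀ j, Tendsto (fun t : ℕ => N.zeros j t p / t) F (𝓝 0) :=
    N.forall_of_neighbour (Q := fun j => Tendsto (fun t : ℕ => N.zeros j t p / t) F (𝓝 0))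
      (fun k l hkl hk => hp.tendsto_zeros hkl inf_le_left hk) (tendsto_comap.mono_left inf_le_right)
  have hsum : Tendsto (fun t : ℕ => N.weightedZeros v t p / t) F (𝓝 0) := by
    have := tendsto_finsetSum Finset.univ fun j (_ : j ∈ Finset.univ) =>
      (hall j).const_mul (N.zeroWeight v j)
    simp only [mul_zero, Finset.sum_const_zero] at this
    refine this.congr fun t => ?_
    rw [weightedZeros_eq, Finset.sum_div]
    simp only [mul_div_assoc]
  exact hη.not_ge (ge_of_tendsto hsum (inf_le_left (a := atTop) h))

end OpinionModel

/-! ### Contraction of the odds, and the linearized drift at consensus to 0. -/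

namespace OpinionModel

variable {n : ℕ} {N : OpinionModel n} {v : Fin n → ℝ} {p : ℕ → Fin n → Bool}

/-- The right Perron eigenvector of `Γ W`, in terms of the left one. -/
def rightVec (N : OpinionModel n) (v : Fin n → ℝ) (i : Fin n) : ℝ := v i * N.γ i / N.deg i

theorem rightVec_pos (hpos : ∀ i, 0 < v i) (i : Fin n) : 0 < N.rightVec v i :=
  div_pos (mul_pos (hpos i) (N.γ_pos i)) (N.deg_pos i)

/-- Jensen bounds the observed odds by the W-average of the individual bounds, the response
multiplies them by γ, and ΓW scales the right eigenvector by λ. -/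
theorem prob_le_of_ones_le (hv : Matrix.vecMul v N.ΓW = lambdaMax N.ΓW • v)
    (hpos : ∀ i, 0 < v i) {θ : ℝ} (hθ : 0 < θ) {t : ℕ} (ht : 1 ≤ t)
    (h : ∀ j, N.ones j t p / t ≤ θ * N.rightVec v j / (1 + θ * N.rightVec v j)) (i : Fin n) :
    N.prob i t p ≤ lambdaMax N.ΓW * θ * N.rightVec v i /
      (1 + lambdaMax N.ΓW * θ * N.rightVec v i) := by
  have hu := rightVec_pos (N := N) hpos
  have hs : ∀ j, 0 < θ * N.rightVec v j := fun j => mul_pos hθ (hu j)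
  set y := ∑ j, N.W i j * (θ * N.rightVec v j)
  have hy : 0 < y := N.sum_W_mul_pos i hs
  have hγy : N.γ i * y = lambdaMax N.ΓW * θ * N.rightVec v i := by
    have := γ_mul_sum_W hv i
    change N.γ i * ∑ j, N.W i j * N.rightVec v j = lambdaMax N.ΓW * N.rightVec v i at this
    simp only [y, mul_left_comm _ θ, ← Finset.mul_sum, this]
    ring
  rw [← hγy]
  refine declareProb_le_of_le_odds (N.γ_pos i) (N.observed_pos p ht i)
    (N.observed_lt_one p ht i) hy ?_
  refine le_trans ?_ (sum_mul_div_one_add_le (N.W_nonneg i) (N.sum_W i) fun j => (hs j).le)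
  rw [observed_eq N p ht, Finset.sum_div]
  refine Finset.sum_le_sum fun j _ => ?_
  rw [mul_div_assoc]
  exact mul_le_mul_of_nonneg_left (h j) (N.W_nonneg i j)

/-- A bound on the odds of the declared opinions, proportional to the right eigenvector, improves
by any factor larger than the eigenvalue. -/
theorem FollowsDrift.eventually_ones_le (hp : N.FollowsDrift p)
    (hv : Matrix.vecMul v N.ΓW = lambdaMax N.ΓW • v) (hpos : ∀ i, 0 < v i)
    (hlam0 : 0 < lambdaMax N.ΓW) {l θ : ℝ} (hl : lambdaMax N.ΓW < l) (hθ : 0 < θ)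
    (h : ∀ᶠ t : ℕ in atTop, ∀ j,
      N.ones j t p / t ≤ θ * N.rightVec v j / (1 + θ * N.rightVec v j)) :
    ∀ᶠ t : ℕ in atTop, ∀ j,
      N.ones j t p / t ≤ l * θ * N.rightVec v j / (1 + l * θ * N.rightVec v j) := by
  have hu := rightVec_pos (N := N) hpos
  refine eventually_all.2 fun i => ?_
  set a := lambdaMax N.ΓW * θ * N.rightVec v i / (1 + lambdaMax N.ΓW * θ * N.rightVec v i)
  set b := l * θ * N.rightVec v i / (1 + l * θ * N.rightVec v i)
  have ha0 : 0 < lambdaMax N.ΓW * θ * N.rightVec v i := mul_pos (mul_pos hlam0 hθ) (hu i)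
  have ha : 0 ≤ a := by positivity
  have hab : a < b := by
    refine div_one_add_lt_div_one_add ha0.le ?_
    have := hu i
    gcongr
  -- Half of the gap b - a absorbs the fluctuations, the other half the constants divided by t.
  obtain ⟨K, hK⟩ := hp i ((b - a) / 2) (by linarith)
  obtain ⟨L, hL⟩ := exists_sum_Ico_le_of_eventually_nonpos (h := fun s => N.prob i s p - a) (by
    filter_upwards [h, eventually_ge_atTop 1] with s hs hs1
    exact sub_nonpos.2 (prob_le_of_ones_le hv hpos hθ hs1 hs i))
  filter_upwards [(tendsto_const_div_atTop_nhds_zero_nat (K + L)).eventually_lt_const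
    (by linarith : 0 < (b - a) / 2), eventually_ge_atTop 1] with t h1 ht
  have ht0 : (0 : ℝ) < t := by positivity
  have h2 := hK t ht
  have h3 := hL t
  rw [Finset.sum_sub_distrib] at h3
  have h4 : ∑ s ∈ Finset.Ico 1 t, a ≤ a * t := by
    rw [Finset.sum_const, nsmul_eq_mul, mul_comm, Nat.card_Ico]
    gcongr
    exact Nat.sub_le t 1
  rw [div_lt_iff₀ ht0] at h1
  rw [div_le_iff₀ ht0]
  linarith

/-- The lower bounds on the frequencies of 0 give a first finite bound θ for the odds; each
application of `eventually_ones_le` multiplies it by l = (1 + λ)/2 < 1. -/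
theorem FollowsDrift.tendsto_ones (hp : N.FollowsDrift p)
    (hv : Matrix.vecMul v N.ΓW = lambdaMax N.ΓW • v) (hpos : ∀ i, 0 < v i)
    (hlam0 : 0 < lambdaMax N.ΓW) (hlam : lambdaMax N.ΓW < 1) {η : ℝ} (hη : 0 < η)
    (h : ∀ᶠ t : ℕ in atTop, η ≤ N.weightedZeros v t p / t) (i : Fin n) :
    Tendsto (fun t : ℕ => N.ones i t p / t) atTop (𝓝 0) := by
  have hu := rightVec_pos (N := N) hpos
  have h1 := hp.exists_eventually_le_zeros hη h
  choose e he0 he using h1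
  obtain ⟨θ, hθ, hθe⟩ : ∃ θ : ℝ, 0 < θ ∧ ∀ j, (e j * N.rightVec v j)⁻¹ ≤ θ :=
    ((eventually_gt_atTop (0 : ℝ)).and
      (eventually_all.2 fun j => eventually_ge_atTop (e j * N.rightVec v j)⁻¹)).exists
  set l := (1 + lambdaMax N.ΓW) / 2
  have hl0 : 0 < l := by positivity
  have key : ∀ k : ℕ, ∀ᶠ t : ℕ in atTop, ∀ j, N.ones j t p / t ≤
      l ^ k * θ * N.rightVec v j / (1 + l ^ k * θ * N.rightVec v j) := by
    intro k
    induction k with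
    | zero =>
      filter_upwards [eventually_all.2 he, eventually_ge_atTop 1] with t ht ht1 j
      have ht0 : (0 : ℝ) < t := by positivity
      have h2 := ht j
      have h3 := hu j
      have h4 : 1 ≤ e j * (θ * N.rightVec v j) := by
        have h5 := (inv_le_iff_one_le_mul₀ (mul_pos (he0 j) h3)).1 (hθe j)
        linarith
      have h6 : N.ones j t p / t = 1 - N.zeros j t p / t := by
        rw [eq_sub_iff_add_eq, ← add_div, N.ones_add_zeros j ht1, div_self ht0.ne']
      rw [pow_zero, one_mul, h6, le_div_iff₀ (by positivity)]
      have h7 := mul_le_mul_of_nonneg_right h2 (mul_pos hθ h3).le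
      linarith [he0 j]
    | succ k ih =>
      have := hp.eventually_ones_le hv hpos hlam0 (l := l) (by simp only [l]; linarith)
        (by positivity) ih
      simpa only [pow_succ', mul_assoc] using this
  have hpow : Tendsto (fun k : ℕ => l ^ k * θ * N.rightVec v i) atTop (𝓝 0) := by
    have := ((tendsto_pow_atTop_nhds_zero_of_lt_one hl0.le (by
      simp only [l]
      linarith)).mul_const θ).mul_const (N.rightVec v i)
    simpa using this
  rw [Metric.tendsto_nhds]
  intro ε hε
  obtain ⟨k, hk⟩ := (hpow.eventually_lt_const hε).exists
  filter_upwards [key k] with t ht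
  have h0 : 0 ≤ N.ones i t p / t := div_nonneg (N.ones_pos i t p).le t.cast_nonneg
  rw [Real.dist_eq, sub_zero, abs_of_nonneg h0]
  refine (ht i).trans_lt (lt_of_le_of_lt ?_ hk)
  have h3 : 0 ≤ l ^ k * θ * N.rightVec v i := mul_nonneg (by positivity) (hu i).le
  exact div_le_self h3 (by linarith)

/-- The weighted number of declarations of `1`. -/
def weightedOnes (N : OpinionModel n) (v : Fin n → ℝ) : ℕ → (ℕ → Fin n → Bool) → ℝ :=
  tally (∑ i, v i * N.b i) fun x => ∑ i, v i * opinionValue (x i)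

theorem weightedOnes_eq (t : ℕ) (p : ℕ → Fin n → Bool) :
    N.weightedOnes v t p = ∑ i, v i * N.ones i t p :=
  (sum_mul_tally v N.b opinionValue t p).symm

theorem drift_weightedOnes (t : ℕ) (p : ℕ → Fin n → Bool) :
    N.drift (fun x => ∑ i, v i * opinionValue (x i)) t p = ∑ i, v i * N.prob i t p := by
  rw [N.drift_sum v opinionValue]
  simp [opinionValue]

/-- The linearized drift of the weighted count is exactly λX/t; this is why the left eigenvector is
the right choice of weights. -/
theorem sum_mul_observed (hv : Matrix.vecMul v N.ΓW = lambdaMax N.ΓW • v) {t : ℕ} (ht : 1 ≤ t) :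
    ∑ i, v i * (N.γ i * N.observed p t i) = lambdaMax N.ΓW * (N.weightedOnes v t p / t) := by
  calc ∑ i, v i * (N.γ i * N.observed p t i)
      = (∑ i, v i * N.γ i * ∑ j, N.W i j * N.ones j t p) / t := by
        rw [Finset.sum_div]
        refine Finset.sum_congr rfl fun i _ => ?_
        rw [observed_eq N p ht]
        ring
    _ = lambdaMax N.ΓW * (N.weightedOnes v t p / t) := by
        rw [sum_mul_sum_W, weightedOnes_eq, mul_div_assoc', Finset.mul_sum]
        congr 1
        refine Finset.sum_congr rfl fun j _ => ?_
        rw [← mul_assoc, ← sum_mul_ΓW hv j]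
        simp only [mul_assoc]

theorem tendsto_observed (h : ∀ i, Tendsto (fun t : ℕ => N.ones i t p / t) atTop (𝓝 0))
    (i : Fin n) : Tendsto (fun t => N.observed p t i) atTop (𝓝 0) := by
  have := tendsto_finsetSum Finset.univ fun j (_ : j ∈ Finset.univ) => (h j).const_mul (N.W i j)
  simp only [mul_zero, Finset.sum_const_zero] at this
  refine this.congr' ?_
  filter_upwards [eventually_ge_atTop 1] with t ht
  rw [observed_eq N p ht, Finset.sum_div]
  simp only [mul_div_assoc]

theorem eventually_le_drift_weightedOnes (hv : Matrix.vecMul v N.ΓW = lambdaMax N.ΓW • v)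
    (hpos : ∀ i, 0 < v i) (h : ∀ i, Tendsto (fun t : ℕ => N.ones i t p / t) atTop (𝓝 0)) {c : ℝ}
    (hc : 0 < c) (hcl : c < lambdaMax N.ΓW) :
    ∀ᶠ t : ℕ in atTop, c * (N.weightedOnes v t p / t) ≤
      N.drift (fun x => ∑ i, v i * opinionValue (x i)) t p := by
  set η := lambdaMax N.ΓW / c - 1
  have hη : 0 < η := sub_pos.2 ((one_lt_div hc).2 hcl)
  have hcη : c * (1 + η) = lambdaMax N.ΓW := by
    simp only [η]
    field_simp
    ring
  have h1 : ∀ᶠ t : ℕ in atTop, ∀ i, N.γ i * N.observed p t i < η :=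
    eventually_all.2 fun i => ((tendsto_observed h i).const_mul (N.γ i)).eventually_lt_const
      (by simpa using hη)
  filter_upwards [h1, eventually_ge_atTop 1] with t h2 ht
  rw [← mul_le_mul_iff_of_pos_right (by linarith : 0 < 1 + η), mul_right_comm, hcη,
    ← sum_mul_observed hv ht, drift_weightedOnes, Finset.sum_mul]
  refine Finset.sum_le_sum fun i _ => ?_
  rw [mul_assoc]
  refine mul_le_mul_of_nonneg_left ?_ (hpos i).le
  rw [← div_le_iff₀ (by linarith)]
  exact div_le_declareProb (N.γ_pos i) (N.observed_pos p ht i) (N.observed_lt_one p ht i) (h2 i).le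

theorem eventually_drift_weightedOnes_le (hv : Matrix.vecMul v N.ΓW = lambdaMax N.ΓW • v)
    (hpos : ∀ i, 0 < v i) (h : ∀ i, Tendsto (fun t : ℕ => N.ones i t p / t) atTop (𝓝 0)) {c : ℝ}
    (hlam0 : 0 < lambdaMax N.ΓW) (hcl : lambdaMax N.ΓW < c) :
    ∀ᶠ t : ℕ in atTop, N.drift (fun x => ∑ i, v i * opinionValue (x i)) t p ≤
      c * (N.weightedOnes v t p / t) := by
  have hc : 0 < c := hlam0.trans hcl
  set η := 1 - lambdaMax N.ΓW / c
  have hη : 0 < η := sub_pos.2 ((div_lt_one hc).2 hcl)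
  have hη1 : 0 < 1 - η := by
    simp only [η, sub_sub_cancel]
    positivity
  have hcη : c * (1 - η) = lambdaMax N.ΓW := by
    simp only [η]
    field_simp
    ring
  have h1 : ∀ᶠ t : ℕ in atTop, ∀ i, N.observed p t i < η :=
    eventually_all.2 fun i => (tendsto_observed h i).eventually_lt_const hη
  filter_upwards [h1, eventually_ge_atTop 1] with t h2 ht
  rw [← mul_le_mul_iff_of_pos_right hη1, mul_right_comm, hcη,
    ← sum_mul_observed hv ht, drift_weightedOnes, Finset.sum_mul]
  refine Finset.sum_le_sum fun i _ => ?_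
  rw [mul_assoc]
  refine mul_le_mul_of_nonneg_left ?_ (hpos i).le
  rw [← le_div_iff₀ hη1]
  refine (declareProb_le (N.γ_pos i) (N.observed_pos p ht i) (N.observed_lt_one p ht i)).trans ?_
  have h3 := mul_pos (N.γ_pos i) (N.observed_pos p ht i)
  have h4 := h2 i
  gcongr

theorem ae_followsDrift {Ω : Type*} [MeasurableSpace Ω] {P : Measure Ω} [IsProbabilityMeasure P]
    {ψ : ℕ → Ω → Fin n → Bool} (hψ : IsOpinionProcess N P ψ) :
    ∀ᵐ ω ∂P, N.FollowsDrift fun τ => ψ τ ω :=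
  ae_all_iff.2 fun i => ae_ones_le hψ i

end OpinionModel

/-! ### From growth of the count to the decay rate of V. -/

theorem tendsto_div_rpow_of_growth {X : ℕ → ℝ} {l ε : ℝ} (hX : ∀ t, 0 ≤ X t) (hε : 0 < ε) {K : ℝ}
    (h : ∀ t : ℕ, 1 ≤ t → X t ≤ K * (t : ℝ) ^ (l + ε / 2)) :
    Tendsto (fun t : ℕ => X t / t / (t : ℝ) ^ (l - 1 + ε)) atTop (𝓝 0) := by
  have hlim : Tendsto (fun t : ℕ => K * (t : ℝ) ^ (-(ε / 2))) atTop (𝓝 0) := by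
    simpa using ((tendsto_rpow_neg_atTop (by linarith : 0 < ε / 2)).comp
      tendsto_natCast_atTop_atTop).const_mul K
  refine squeeze_zero' (Eventually.of_forall fun t => ?_) ?_ hlim
  · exact div_nonneg (div_nonneg (hX t) t.cast_nonneg) (Real.rpow_nonneg t.cast_nonneg _)
  · filter_upwards [eventually_ge_atTop 1] with t ht
    have ht0 : (0 : ℝ) < t := by positivity
    rw [div_le_iff₀ (Real.rpow_pos_of_pos ht0 _), div_le_iff₀ ht0, mul_assoc, mul_assoc,
      ← Real.rpow_add_one ht0.ne', ← Real.rpow_add ht0,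
      show -(ε / 2) + (l - 1 + ε + 1) = l + ε / 2 by ring]
    exact h t ht

theorem tendsto_div_rpow_atTop_of_growth {X : ℕ → ℝ} {l ε c : ℝ} (hc : l - ε < c) {κ : ℝ}
    (hκ : 0 < κ) (h : ∀ t : ℕ, 1 ≤ t → κ * (t : ℝ) ^ c ≤ X t) :
    Tendsto (fun t : ℕ => X t / t / (t : ℝ) ^ (l - 1 - ε)) atTop atTop := by
  have hlim : Tendsto (fun t : ℕ => κ * (t : ℝ) ^ (c - (l - ε))) atTop atTop :=
    ((tendsto_rpow_atTop (sub_pos.2 hc)).comp tendsto_natCast_atTop_atTop).const_mul_atTop hκ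
  refine tendsto_atTop_mono' atTop ?_ hlim
  filter_upwards [eventually_ge_atTop 1] with t ht
  have ht0 : (0 : ℝ) < t := by positivity
  rw [le_div_iff₀ (Real.rpow_pos_of_pos ht0 _), le_div_iff₀ ht0, mul_assoc, mul_assoc,
    ← Real.rpow_add_one ht0.ne', ← Real.rpow_add ht0,
    show c - (l - ε) + (l - 1 - ε + 1) = c by ring]
  exact h t ht

end

theorem mainTheorem5 {Ω : Type*} [MeasurableSpace Ω] (P : Measure Ω) [IsProbabilityMeasure P]
    {n : ℕ} (N : OpinionModel n) (ψ : ℕ → Ω → Fin n → Bool) (hψ : IsOpinionProcess N P ψ)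
    (hlam : lambdaMax N.ΓW < 1)
    (v : Fin n → ℝ) (hv : Matrix.vecMul v N.ΓW = lambdaMax N.ΓW • v) (hv1 : ∑ i, v i = 1) :
    ∀ᵐ ω ∂P, ∀ ε : ℝ, 0 < ε →
      Tendsto (fun t : ℕ => (∑ i, v i * N.declared (fun τ => ψ τ ω) t i) /
        (t : ℝ) ^ (lambdaMax N.ΓW - 1 + ε)) atTop (𝓝 0) ∧
      Tendsto (fun t : ℕ => (∑ i, v i * N.declared (fun τ => ψ τ ω) t i) /
        (t : ℝ) ^ (lambdaMax N.ΓW - 1 - ε)) atTop atTop := by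
  have hpos := OpinionModel.eigenvector_pos hv hv1
  have hlam0 := OpinionModel.lambdaMax_pos hv hv1
  have hn : Nonempty (Fin n) := by
    by_contra hcon
    rw [not_nonempty_iff] at hcon
    simp at hv1
  have hx₀ : 0 < ∑ i, v i * N.b i :=
    Finset.sum_pos (fun i _ => mul_pos (hpos i) (N.b_pos i)) Finset.univ_nonempty
  have hξ : ∀ x : Fin n → Bool, 0 ≤ ∑ i, v i * opinionValue (x i) := fun x =>
    Finset.sum_nonneg fun i _ => mul_nonneg (hpos i).le (opinionValue_nonneg _)
  have hξC : ∀ x : Fin n → Bool, ∑ i, v i * opinionValue (x i) ≤ 1 := fun x =>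
    hv1 ▸ Finset.sum_le_sum fun i _ => mul_le_of_le_one_right (hpos i).le (opinionValue_le_one _)
  filter_upwards [OpinionModel.ae_followsDrift hψ,
    OpinionModel.ae_eventually_le_weightedZeros hψ hn hv hpos hlam0 hlam,
    ae_tally_le_exp hψ hx₀ hξ, ae_exp_le_tally hψ hx₀ hξ hξC] with ω hdrift hzeros hup hlow ε hε
  set p : ℕ → Fin n → Bool := fun τ => ψ τ ω
  obtain ⟨η, hη, hzeros⟩ := hzeros
  obtain ⟨K, hK, hup⟩ := hup
  obtain ⟨κ, hκ, hlow⟩ := hlow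
  have hones := hdrift.tendsto_ones hv hpos hlam0 hlam hη hzeros
  have hXpos : ∀ t, 0 < N.weightedOnes v t p := fun t => hx₀.trans_le (le_tally hξ t p)
  have hV : ∀ t : ℕ, ∑ i, v i * N.declared p t i = N.weightedOnes v t p / t := fun t => by
    rw [OpinionModel.weightedOnes_eq, Finset.sum_div]
    exact Finset.sum_congr rfl fun i _ => by rw [OpinionModel.declared_eq, mul_div_assoc]
  simp only [hV]
  set l := lambdaMax N.ΓW
  constructor
  · obtain ⟨K', -, hgrow⟩ := exists_le_rpow hXpos hK hup (by linarith : 0 ≤ l + ε / 2)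
      (OpinionModel.eventually_drift_weightedOnes_le hv hpos hones hlam0
        (by linarith : l < l + ε / 2))
    exact tendsto_div_rpow_of_growth (fun t => (hXpos t).le) hε hgrow
  -- The maximum with 0 is needed because λ - ε may be negative, while the growth lemma requires a
  -- nonnegative exponent.
  · obtain ⟨c', h1, h2⟩ := exists_between (max_lt hlam0 (sub_lt_self l hε))
    obtain ⟨c, h3, h4⟩ := exists_between h2
    have hc' := (le_max_left _ _).trans_lt h1
    obtain ⟨κ', hκ', hgrow⟩ := exists_rpow_le hx₀ (fun t => le_tally hξ t p) zero_le_one hκ hlow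
      (hc'.trans h3)
      (OpinionModel.eventually_le_drift_weightedOnes hv hpos hones (hc'.trans h3) h4) hc'.le h3
    exact tendsto_div_rpow_atTop_of_growth ((le_max_right _ _).trans_lt h1) hκ' hgrow
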